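/- **Setup.** Let $\Phi^t:\Omega\to\Omega$, $t\in\mathbb R$, be a continuous flow on a metric space $\Omega$ with an invariant, ergodic Borel probability measure $\mu$ whose support $X$ is compact and has full measure. Let $M\subseteq\Omega$ be a compact, forward-invariant $C^1$ manifold (possibly with boundary) containing $X$, such that $\Phi^t|_M$ is $C^1$ for $t\ge 0$ and the flow on $M$ is generated by a continuous vector field $\vec V$; fix a continuous Riemannian metric on $M$ and the product metric on $M\times M$. For $f\in C^1(M)$ put $\mathcal V f=\vec V\cdot\nabla f$ and $\|f\|_{C^1(M)}=\sup_M|f|+\sup_M|df|$, similarly on $M\times M$, and let $\|\mathcal V\|$ be the norm of the operator $\mathcal V:C^1(M)\to C(M)$. Let $U^tf=f\circ\Phi^t$ be the Koopman operators on the complex space $L^2(\mu)$, with inner product $\langle f,g\rangle=\int \bar f g\,d\mu$, and let $V f=\frac{d}{dt}U^tf|_{t=0}$ be their generator, with domain $D(V)$. Let $F:\Omega\to Y$ be a continuous map into a Banach space whose restriction to $M$ is $C^1$, let $d(x,x')=\|F(x)-F(x')\|_Y$, and assume that $d^2$ is $C^1$ on $M\times M$. Let $h:[0,\infty)\to(0,\infty)$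 be $C^1$ and bounded with bounded derivative, and $\|h\|_{C^1(\mathbb R_+)}=\sup|h|+\sup|h'|$. For $T>0$ let $$d_T^2(x,x')=\frac1T\int_0^T d^2(\Phi^t(x),\Phi^t(x'))\,dt,\qquad k_T=h\circ d_T^2,\qquad K_Tf=\int_\Omega k_T(\cdot,x)f(x)\,d\mu(x),$$ where $K_T$ acts on $L^2(\mu)$ and has point spectrum $\sigma_p(K_T)$. Let $\phi,\psi\in L^2(\mu)$ be real, of unit norm and mutually orthogonal, with $K_T\phi=\lambda_T\phi$, $K_T\psi=\nu_T\psi$ and $0<\lambda_T\le\nu_T$, where $\lambda_T,\nu_T$ are simple eigenvalues if they are distinct and twofold degenerate if they are equal. Put $z=(\phi+i\psi)/\sqrt2$, $\alpha_t=\langle z,U^tz\rangle$, and $$\gamma_T=\inf_{u\in\sigma_p(K_T)\setminus\{\lambda_T,\nu_T\}}\min\{|\lambda_T-u|,|\nu_T-u|\},\quad \delta_T=\frac{\nu_T-\lambda_T}{\sqrt2},\quad \tilde\delta_T=\frac{\delta_T}{\nu_T},$$ $$s_t=\frac1{\gamma_T}\Big(\frac{C_1t}{T}+3\delta_T\Big),\quad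 S_t=\frac{C_2\|\mathcal V\|(1+\tilde\delta_T)}{\lambda_T}\int_0^t s_u\,du,\quad \epsilon_t=s_t+3\sqrt{S_t},$$ $$C_1=2\|h\|_{C^1(\mathbb R_+)}\sup_{X\times X}d^2,\qquad C_2=2\|h\|_{C^1(\mathbb R_+)}\|d^2\|_{C^1(M\times M)}.$$ For $\epsilon\ge0$, call $(c,w)$ with $c\in\mathbb C$, $0\ne w\in L^2(\mu)$ an $\epsilon$-approximate eigenpair of $U^t$ if $\|U^tw-cw\|\le\epsilon\|w\|$; then $w$ is an $\epsilon$-approximate eigenfunction, and the set of all such $c$ is the $\epsilon$-approximate point spectrum of $U^t$. **Corollary.** The functions $\phi,\psi,z$ lie in $D(V)$, the number $$\omega=\tfrac1i\langle z,Vz\rangle=\langle\phi,V\psi\rangle=\tfrac1i\dot\alpha_t|_{t=0}$$ is real, $\gamma_T>0$, and: 1. For every $t\ge0$, $e^{i\omega t}$ lies in the $\epsilon_t$-approximate point spectrum of $U^t$, and $z$ is a corresponding $\epsilon_t$-approximate eigenfunction. 2. For every $\tau\ge0$, $(e^{i\omega t},z)$ is an $\epsilon_\tau$-approximate eigenpair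 of $U^t$ for all $t\in[0,\tau]$. 3. The function $$\zeta=\frac1{\sqrt2}\int_\Omega k_T(\cdot,x)\Big(\frac{\phi(x)}{\lambda_T}+i\frac{\psi(x)}{\nu_T}\Big)d\mu(x)$$ is defined everywhere on $\Omega$ (the integrand is integrable for every argument), continuous on $\Omega$, and equal to $z$ $\mu$-almost everywhere. -/

import Mathlib

open Set Filter Topology MeasureTheory Manifold Bundle
open scoped BoundedContinuousFunction

noncomputable section

namespace KoopmanDelay

/-! ### Flows, Koopman operators, the generator -/

section Dynamics

variable {Ω : Type*} [MetricSpace Ω] [MeasurableSpace Ω] [BorelSpace Ω]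

/-- `μ` is invariant under every time-`t` map of the flow. -/
def IsInvariant (Φ : Flow ℝ Ω) (μ : Measure Ω) : Prop :=
  ∀ t : ℝ, MeasurePreserving (Φ t) μ μ

/-- Ergodicity of a probability measure: Borel sets invariant under the flow are trivial. -/
def IsErgodic (Φ : Flow ℝ Ω) (μ : Measure Ω) : Prop :=
  ∀ A : Set Ω, MeasurableSet A → (∀ t : ℝ, Φ t ⁻¹' A = A) → μ A = 0 ∨ μ A = 1

/-- The Koopman operator `U^t f = f ∘ Φ^t` on `L²(μ)`. -/
def koopman {μ : Measure Ω} (Φ : Flow ℝ Ω) (hinv : IsInvariant Φ μ) (t : ℝ) :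
    Lp ℂ 2 μ →ₗᵢ[ℂ] Lp ℂ 2 μ :=
  Lp.compMeasurePreservingₗᵢ ℂ (Φ t) (hinv t)

/-- The generator `V` of the Koopman group, `V f = d/dt U^t f` at `t = 0`, with domain the set of
all `f ∈ L²(μ)` for which this derivative exists in `L²(μ)`. -/
def generator {μ : Measure Ω} (Φ : Flow ℝ Ω) (hinv : IsInvariant Φ μ) :
    Lp ℂ 2 μ →ₗ.[ℂ] Lp ℂ 2 μ where
  domain :=
    { carrier := {f | DifferentiableAt ℝ (fun t : ℝ => koopman Φ hinv t f) 0}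
      add_mem' := by
        intro f g hf hg
        simp only [mem_ofPred_eq, map_add] at *
        exact hf.add hg
      zero_mem' := by simp
      smul_mem' := by
        intro c f hf
        simp only [mem_ofPred_eq, map_smul] at *
        exact hf.const_smul c }
  toFun :=
    { toFun := fun f => deriv (fun t : ℝ => koopman Φ hinv t (f : Lp ℂ 2 μ)) 0
      map_add' := by
        rintro ⟨f, hf⟩ ⟨g, hg⟩
        change deriv (fun t : ℝ => koopman Φ hinv t (f + g)) 0 = _
        simp only [map_add]
        exact deriv_fun_add hf hg
      map_smul' := by
        rintro c ⟨f, hf⟩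
        change deriv (fun t : ℝ => koopman Φ hinv t (c • f)) 0 = _
        simp only [map_smul, RingHom.id_apply]
        exact deriv_fun_const_smul c hf }

end Dynamics

/-! ### Approximate point spectrum -/

section Approx

variable {G : Type*} [NormedAddCommGroup G] [NormedSpace ℂ G]

/-- `(c, z)` is an `ε`-approximate eigenpair of `U`: `z ≠ 0` and `‖U z - c z‖ ≤ ε ‖z‖`. -/
def IsApproxEigenpair (U : G → G) (ε : ℝ) (c : ℂ) (z : G) : Prop :=
  z ≠ 0 ∧ ‖U z - c • z‖ ≤ ε * ‖z‖

/-- The `ε`-approximate point spectrum of `U`. -/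
def approxPointSpectrum (U : G → G) (ε : ℝ) : Set ℂ :=
  {c | ∃ z, IsApproxEigenpair U ε c z}

end Approx

/-! ### Norms of continuously differentiable functions -/

section Norms

/-- The supremum of `|f|` over the set `s`. -/
def supNormOn {α : Type*} (s : Set α) (f : α → ℝ) : ℝ := sSup ((fun x => |f x|) '' s)

/-- The `C¹` norm of a function on the half-line `[0, ∞)`. -/
def halfLineC1Norm (h : ℝ → ℝ) : ℝ :=
  supNormOn (Ici 0) h + supNormOn (Ici 0) (derivWithin h (Ici 0))

/-- Admissible shape functions: positive, `C¹`, bounded, with bounded derivative on `[0, ∞)`.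
The values on the negative half-line are irrelevant. -/
structure IsShapeFunction (h : ℝ → ℝ) : Prop where
  pos : ∀ u, 0 ≤ u → 0 < h u
  contDiffOn : ContDiffOn ℝ 1 h (Ici 0)
  bounded : ∃ B : ℝ, ∀ u, 0 ≤ u → h u ≤ B
  bounded_deriv : ∃ B : ℝ, ∀ u, 0 ≤ u → |derivWithin h (Ici 0) u| ≤ B

variable {E : Type*} [NormedAddCommGroup E] [NormedSpace ℝ E]
  {H : Type*} [TopologicalSpace H] (I : ModelWithCorners ℝ E H)
  {M : Type*} [TopologicalSpace M] [ChartedSpace H M]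
  [RiemannianBundle (fun x : M => TangentSpace I x)]

/-- The norm of the differential of `f : M → ℝ` at `x`, for the Riemannian metric of `M`. -/
def dnorm (f : M → ℝ) (x : M) : ℝ :=
  sSup {r : ℝ | ∃ w : TangentSpace I x, ‖w‖ ≤ 1 ∧ r = |(show ℝ from mfderiv I 𝓘(ℝ, ℝ) f x w)|}

/-- The `C¹(M)` norm. -/
def c1Norm (f : M → ℝ) : ℝ :=
  supNormOn univ f + supNormOn univ (dnorm I f)

/-- The norm of the differential of `f : M × M → ℝ` at `p`, for the product Riemannian metric: the
differential splits into the two partial differentials, which live on orthogonal factors. -/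
def dnormProd (f : M × M → ℝ) (p : M × M) : ℝ :=
  Real.sqrt (dnorm I (fun x => f (x, p.2)) p.1 ^ 2 + dnorm I (fun y => f (p.1, y)) p.2 ^ 2)

/-- The `C¹(M × M)` norm. -/
def c1NormProd (f : M × M → ℝ) : ℝ :=
  supNormOn univ f + supNormOn univ (dnormProd I f)

/-- The directional derivative `𝓥 f = v · ∇ f` along the vector field `v`. -/
def dirDeriv (v : (x : M) → TangentSpace I x) (f : M → ℝ) (x : M) : ℝ :=
  mfderiv I 𝓘(ℝ, ℝ) f x (v x)

/-- The norm of the vector field `v`, viewed as the bounded operator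
`𝓥 : C¹(M) → C(M)`, `f ↦ v · ∇ f`. -/
def vectorFieldNorm (v : (x : M) → TangentSpace I x) : ℝ :=
  sInf {C : ℝ | 0 ≤ C ∧ ∀ f : M → ℝ, ContMDiff I 𝓘(ℝ, ℝ) 1 f →
    supNormOn univ (dirDeriv I v f) ≤ C * c1Norm I f}

end Norms

/-- The forward orbit `t ↦ Φ^t(x)`, `t ≥ 0`, inside a forward-invariant set `M`
(for negative `t` the value is the junk value `x`). -/
def forwardOrbit {Ω : Type*} [TopologicalSpace Ω] (Φ : Flow ℝ Ω) (M : Set Ω)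
    (hM : ∀ t : ℝ, 0 ≤ t → MapsTo (Φ t) M M) (x : M) (t : ℝ) : M :=
  ⟨Φ (max t 0) x, hM _ (le_max_right _ _) x.2⟩

/-! ### Delay-coordinate kernels and their integral operators -/

section Kernel

variable {Ω : Type*} [MetricSpace Ω] {Y : Type*} [NormedAddCommGroup Y]

/-- `d²(x, x') = ‖F(x) - F(x')‖²`. -/
def dSq (F : Ω → Y) (p : Ω × Ω) : ℝ := ‖F p.1 - F p.2‖ ^ 2

/-- `d_T²(x, x') = (1/T) ∫₀ᵀ d²(Φ^t(x), Φ^t(x')) dt`. -/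
def delayDSq (Φ : Flow ℝ Ω) (F : Ω → Y) (T : ℝ) (p : Ω × Ω) : ℝ :=
  (1 / T) * ∫ t in (0 : ℝ)..T, dSq F (Φ t p.1, Φ t p.2)

theorem continuous_delayDSq (Φ : Flow ℝ Ω) {F : Ω → Y} (hF : Continuous F) (T : ℝ) :
    Continuous (delayDSq Φ F T) := by
  unfold delayDSq dSq
  refine continuous_const.mul ?_
  apply intervalIntegral.continuous_parametric_intervalIntegral_of_continuous'
  have h1 : Continuous fun q : (Ω × Ω) × ℝ => Φ q.2 q.1.1 :=
    Φ.continuous continuous_snd (continuous_fst.comp continuous_fst)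
  have h2 : Continuous fun q : (Ω × Ω) × ℝ => Φ q.2 q.1.2 :=
    Φ.continuous continuous_snd (continuous_snd.comp continuous_fst)
  exact ((hF.comp h1).sub (hF.comp h2)).norm.pow 2

theorem delayDSq_nonneg (Φ : Flow ℝ Ω) (F : Ω → Y) {T : ℝ} (hT : 0 < T) (p : Ω × Ω) :
    0 ≤ delayDSq Φ F T p := by
  unfold delayDSq dSq
  refine mul_nonneg (by positivity) (intervalIntegral.integral_nonneg hT.le ?_)
  intro t _
  positivity

/-- The kernel `k_T(x, x') = h(d_T²(x, x'))`, a bounded continuous function on `Ω × Ω`. -/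
def delayKernel (Φ : Flow ℝ Ω) {F : Ω → Y} (hF : Continuous F) {h : ℝ → ℝ}
    (hh : IsShapeFunction h) {T : ℝ} (hT : 0 < T) : Ω × Ω →ᵇ ℝ :=
  BoundedContinuousFunction.ofNormedAddCommGroup (fun p => h (delayDSq Φ F T p))
    (hh.contDiffOn.continuousOn.comp_continuous (continuous_delayDSq Φ hF T)
      (delayDSq_nonneg Φ F hT))
    hh.bounded.choose
    (fun p => by
      have h0 := delayDSq_nonneg Φ F hT p
      rw [Real.norm_of_nonneg (hh.pos _ h0).le]
      exact hh.bounded.choose_spec _ h0)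

theorem norm_kernel_mul_le (k : Ω × Ω →ᵇ ℝ) (f : Ω → ℂ) (x y : Ω) :
    ‖(k (x, y) : ℂ) * f y‖ ≤ ‖k‖ * ‖f y‖ := by
  rw [norm_mul, Complex.norm_real]
  exact mul_le_mul_of_nonneg_right (k.norm_coe_le_norm _) (norm_nonneg _)

variable [MeasurableSpace Ω] [BorelSpace Ω] {μ : Measure Ω}

/-- The everywhere-defined function `x ↦ ∫ k(x, y) f(y) dμ(y)`. -/
def kernelIntegral (μ : Measure Ω) (k : Ω × Ω →ᵇ ℝ) (f : Ω → ℂ) (x : Ω) : ℂ :=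
  ∫ y, (k (x, y) : ℂ) * f y ∂μ

theorem aestronglyMeasurable_kernel_mul (k : Ω × Ω →ᵇ ℝ) {f : Ω → ℂ}
    (hf : AEStronglyMeasurable f μ) (x : Ω) :
    AEStronglyMeasurable (fun y => (k (x, y) : ℂ) * f y) μ := by
  have hk : Continuous fun y => (k (x, y) : ℂ) :=
    Complex.continuous_ofReal.comp (k.continuous.comp (by fun_prop))
  exact hk.measurable.stronglyMeasurable.aestronglyMeasurable.mul hf

theorem integrable_kernel_mul (k : Ω × Ω →ᵇ ℝ) {f : Ω → ℂ} (hf : Integrable f μ) (x : Ω) :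
    Integrable (fun y => (k (x, y) : ℂ) * f y) μ :=
  (hf.norm.const_mul ‖k‖).mono' (aestronglyMeasurable_kernel_mul k hf.1 x)
    (Eventually.of_forall fun y => norm_kernel_mul_le k f x y)

theorem integrable_of_Lp [IsProbabilityMeasure μ] (f : Lp ℂ 2 μ) : Integrable f μ :=
  (Lp.memLp f).integrable (by norm_num)

theorem continuous_kernelIntegral (k : Ω × Ω →ᵇ ℝ) {f : Ω → ℂ} (hf : Integrable f μ) :
    Continuous (kernelIntegral μ k f) := by
  refine continuous_of_dominated (bound := fun y => ‖k‖ * ‖f y‖)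
    (fun x => aestronglyMeasurable_kernel_mul k hf.1 x)
    (fun x => Eventually.of_forall fun y => norm_kernel_mul_le k f x y)
    (hf.norm.const_mul ‖k‖) (Eventually.of_forall fun y => ?_)
  exact (Complex.continuous_ofReal.comp (k.continuous.comp (by fun_prop))).mul continuous_const

theorem memLp_kernelIntegral [IsProbabilityMeasure μ] (k : Ω × Ω →ᵇ ℝ) {f : Ω → ℂ} (hf : Integrable f μ) :
    MemLp (kernelIntegral μ k f) 2 μ := by
  refine MemLp.of_bound
    (continuous_kernelIntegral k hf).measurable.stronglyMeasurable.aestronglyMeasurable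
    (∫ y, ‖k‖ * ‖f y‖ ∂μ) (Eventually.of_forall fun x => ?_)
  exact norm_integral_le_of_norm_le (hf.norm.const_mul ‖k‖)
    (Eventually.of_forall fun y => norm_kernel_mul_le k f x y)

/-- The integral operator `K f = ∫ k(·, y) f(y) dμ(y)` on `L²(μ)`. -/
def kernelOp (μ : Measure Ω) [IsProbabilityMeasure μ] (k : Ω × Ω →ᵇ ℝ) :
    Module.End ℂ (Lp ℂ 2 μ) where
  toFun f := (memLp_kernelIntegral k (integrable_of_Lp f)).toLp _
  map_add' f g := by
    rw [← MemLp.toLp_add]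
    congr 1
    funext x
    rw [Pi.add_apply]
    unfold kernelIntegral
    rw [← integral_add (integrable_kernel_mul k (integrable_of_Lp f) x)
      (integrable_kernel_mul k (integrable_of_Lp g) x)]
    refine integral_congr_ae ?_
    filter_upwards [Lp.coeFn_add f g] with y hy
    rw [hy, Pi.add_apply, mul_add]
  map_smul' c f := by
    rw [RingHom.id_apply, ← MemLp.toLp_const_smul]
    congr 1
    funext x
    rw [Pi.smul_apply]
    unfold kernelIntegral
    rw [← integral_smul]
    refine integral_congr_ae ?_
    filter_upwards [Lp.coeFn_smul c f] with y hy
    rw [hy, Pi.smul_apply, smul_eq_mul, smul_eq_mul]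
    ring

end Kernel

/-- The set of real eigenvalues of a linear operator on a complex vector space; for a self-adjoint
operator this is its whole point spectrum. -/
def realPointSpectrum {G : Type*} [AddCommGroup G] [Module ℂ G] (K : Module.End ℂ G) : Set ℝ :=
  {u | K.HasEigenvalue (u : ℂ)}

/-- The distance from `{a, b}` to the rest of the point spectrum. -/
def spectralGap {G : Type*} [AddCommGroup G] [Module ℂ G] (K : Module.End ℂ G) (a b : ℝ) : ℝ :=
  sInf ((fun u => min |a - u| |b - u|) '' (realPointSpectrum K \ {a, b}))

end KoopmanDelay

end

set_option linter.unusedSectionVars false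

namespace KoopmanDelay

section Spectral

open Module.End

variable {G : Type*} [NormedAddCommGroup G] [InnerProductSpace ℂ G] [CompleteSpace G]

/-- The eigenvectors of a compact symmetric operator span a dense subspace. -/
theorem dense_iSup_eigenspace {K : G →L[ℂ] G} (hK : IsCompactOperator K)
    (hs : (K : G →ₗ[ℂ] G).IsSymmetric) :
    Dense ((⨆ u, eigenspace (K : G →ₗ[ℂ] G) u : Submodule ℂ G) : Set G) := by
  rw [Submodule.dense_iff_topologicalClosure_eq_top, Submodule.topologicalClosure_eq_top_iff]
  exact ContinuousLinearMap.orthogonalComplement_iSup_eigenspaces_eq_bot hK hs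

/-- If all eigenvalues of a compact symmetric operator `K` have distance at least `g` from `a`,
then `K - a` is bounded below by `g`. -/
theorem mul_norm_le_norm_sub_smul {K : G →L[ℂ] G} (hK : IsCompactOperator K)
    (hs : (K : G →ₗ[ℂ] G).IsSymmetric) {a : ℂ} {g : ℝ} (hg : 0 ≤ g)
    (hu : ∀ u : ℂ, HasEigenvalue (K : G →ₗ[ℂ] G) u → g ≤ ‖u - a‖) (r : G) :
    g * ‖r‖ ≤ ‖K r - a • r‖ := by
  have hcl : IsClosed {r : G | g * ‖r‖ ≤ ‖K r - a • r‖} :=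
    isClosed_le (by fun_prop) (by fun_prop)
  refine hcl.closure_subset_iff.2 ?_ (dense_iSup_eigenspace hK hs r)
  intro r hr
  obtain ⟨f, hf, rfl⟩ := (Submodule.mem_iSup_iff_exists_finsupp _ _).1 hr
  have hKf : ∀ u, K (f u) = u • f u := fun u => mem_eigenspace_iff.1 (hf u)
  have hV := hs.orthogonalFamily_eigenspaces
  have h1 : ‖f.sum fun _ x => x‖ ^ 2 = ∑ u ∈ f.support, ‖f u‖ ^ 2 := by
    simpa [Finsupp.sum] using hV.norm_sum (fun u => ⟨f u, hf u⟩) f.support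
  have h2 : K (f.sum fun _ x => x) - a • (f.sum fun _ x => x)
      = ∑ u ∈ f.support, (u - a) • f u := by
    simp only [Finsupp.sum, map_sum, hKf, Finset.smul_sum, ← Finset.sum_sub_distrib, sub_smul]
  have h3 : ‖∑ u ∈ f.support, (u - a) • f u‖ ^ 2 = ∑ u ∈ f.support, ‖(u - a) • f u‖ ^ 2 := by
    simpa using hV.norm_sum (fun u => (u - a) • (⟨f u, hf u⟩ : eigenspace (K : G →ₗ[ℂ] G) u))
      f.support
  change g * ‖f.sum fun _ x => x‖ ≤ ‖K (f.sum fun _ x => x) - a • (f.sum fun _ x => x)‖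
  rw [h2]
  refine le_of_sq_le_sq ?_ (norm_nonneg _)
  rw [mul_pow, h1, h3, Finset.mul_sum]
  refine Finset.sum_le_sum fun u hu' => ?_
  rw [norm_smul, mul_pow]
  have hne : f u ≠ 0 := Finsupp.mem_support_iff.1 hu'
  have := hu u (hasEigenvalue_of_hasEigenvector ⟨hf u, hne⟩)
  gcongr

/-- A compact symmetric operator on a nontrivial space has a real eigenvalue. -/
theorem exists_real_hasEigenvalue [Nontrivial G] {K : G →L[ℂ] G} (hK : IsCompactOperator K)
    (hs : (K : G →ₗ[ℂ] G).IsSymmetric) :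
    ∃ u : ℝ, HasEigenvalue (K : G →ₗ[ℂ] G) (u : ℂ) := by
  by_contra! hcon
  have h : ∀ u : ℂ, eigenspace (K : G →ₗ[ℂ] G) u = ⊥ := by
    intro u
    by_contra hu
    have hu' : HasEigenvalue (K : G →ₗ[ℂ] G) u := hasEigenvalue_iff.2 hu
    have := Complex.conj_eq_iff_real.1 (hs.conj_eigenvalue_eq_self hu')
    obtain ⟨r, rfl⟩ := this
    exact hcon r hu'
  have := ContinuousLinearMap.orthogonalComplement_iSup_eigenspaces_eq_bot hK hs
  simp only [h, iSup_bot, Submodule.bot_orthogonal_eq_top] at this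
  exact top_ne_bot this

section Restriction

variable {K : G →L[ℂ] G} {W : Submodule ℂ G}

theorem map_mem_orthogonal (hs : (K : G →ₗ[ℂ] G).IsSymmetric) (hW : ∀ w ∈ W, K w ∈ W) :
    ∀ r ∈ Wᗮ, K r ∈ Wᗮ := by
  intro r hr w hw
  have := hs w r
  simp only [ContinuousLinearMap.coe_coe] at this
  rw [← this]
  exact hr _ (hW w hw)

/-- The restriction of a symmetric operator to the orthogonal complement of an invariant
subspace. -/
noncomputable def restrictOrthogonal (hs : (K : G →ₗ[ℂ] G).IsSymmetric)
    (hW : ∀ w ∈ W, K w ∈ W) : Wᗮ →L[ℂ] Wᗮ :=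
  (K.comp Wᗮ.subtypeL).codRestrict Wᗮ fun r => map_mem_orthogonal hs hW r r.2

theorem isCompactOperator_restrictOrthogonal (hK : IsCompactOperator K)
    (hs : (K : G →ₗ[ℂ] G).IsSymmetric) (hW : ∀ w ∈ W, K w ∈ W) :
    IsCompactOperator (restrictOrthogonal hs hW) :=
  IsCompactOperator.restrict' (f := (K : G →ₗ[ℂ] G)) hK (map_mem_orthogonal hs hW)

theorem isSymmetric_restrictOrthogonal (hs : (K : G →ₗ[ℂ] G).IsSymmetric)
    (hW : ∀ w ∈ W, K w ∈ W) :
    (restrictOrthogonal hs hW : Wᗮ →ₗ[ℂ] Wᗮ).IsSymmetric :=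
  fun x y => hs x y

theorem hasEigenvalue_of_restrictOrthogonal (hs : (K : G →ₗ[ℂ] G).IsSymmetric)
    (hW : ∀ w ∈ W, K w ∈ W) {u : ℂ}
    (hu : HasEigenvalue (restrictOrthogonal hs hW : Wᗮ →ₗ[ℂ] Wᗮ) u) :
    ∃ x ∈ Wᗮ, x ≠ 0 ∧ K x = u • x := by
  obtain ⟨x, hx⟩ := hu.exists_hasEigenvector
  refine ⟨x, x.2, fun h0 => hx.2 (Subtype.ext h0), ?_⟩
  exact congrArg Subtype.val hx.apply_eq_smul

end Restriction

end Spectral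

section Gap

open Module.End

variable {G : Type*} [NormedAddCommGroup G] [InnerProductSpace ℂ G] [CompleteSpace G]
  {K : G →L[ℂ] G} {a b : ℝ} {φ ψ : G}

theorem map_mem_span_pair (hφ : K φ = (a : ℂ) • φ) (hψ : K ψ = (b : ℂ) • ψ) :
    ∀ w ∈ Submodule.span ℂ {φ, ψ}, K w ∈ Submodule.span ℂ {φ, ψ} := by
  intro w hw
  obtain ⟨c, d, rfl⟩ := Submodule.mem_span_pair.1 hw
  refine Submodule.mem_span_pair.2 ⟨c * a, d * b, ?_⟩
  simp [hφ, hψ, mul_smul]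

theorem mem_orthogonal_span_pair {r : G} :
    r ∈ (Submodule.span ℂ {φ, ψ})ᗮ ↔ inner ℂ φ r = 0 ∧ inner ℂ ψ r = 0 := by
  rw [Submodule.mem_orthogonal]
  constructor
  · intro h
    exact ⟨h _ (Submodule.subset_span (by simp)), h _ (Submodule.subset_span (by simp))⟩
  · rintro ⟨h1, h2⟩ w hw
    obtain ⟨c, d, rfl⟩ := Submodule.mem_span_pair.1 hw
    simp [inner_add_left, inner_smul_left, h1, h2]

/-- Eigenvectors for eigenvalues other than `a`, `b` are orthogonal to `φ`, `ψ`. -/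
theorem mem_orthogonal_of_eigenvector (hs : (K : G →ₗ[ℂ] G).IsSymmetric)
    (hφ : K φ = (a : ℂ) • φ) (hψ : K ψ = (b : ℂ) • ψ) {u : ℝ} (hua : u ≠ a) (hub : u ≠ b) {r : G}
    (hr : K r = (u : ℂ) • r) : r ∈ (Submodule.span ℂ {φ, ψ})ᗮ := by
  have key : ∀ (c : ℝ) (x : G), u ≠ c → K x = (c : ℂ) • x → inner ℂ x r = 0 := by
    intro c x hc hx
    have := hs x r
    simp only [ContinuousLinearMap.coe_coe, hx, hr, inner_smul_left, inner_smul_right,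
      Complex.conj_ofReal] at this
    rw [mul_eq_mul_right_iff] at this
    refine this.resolve_left fun h => hc ?_
    exact_mod_cast h.symm
  exact mem_orthogonal_span_pair.2 ⟨key a φ hua hφ, key b ψ hub hψ⟩

theorem spectralGap_pos
    (hK : IsCompactOperator K) (hs : (K : G →ₗ[ℂ] G).IsSymmetric)
    (hφ : K φ = (a : ℂ) • φ) (hψ : K ψ = (b : ℂ) • ψ)
    (hE : ∀ r, inner ℂ φ r = 0 → inner ℂ ψ r = 0 →
      K r = (a : ℂ) • r ∨ K r = (b : ℂ) • r → r = 0) (ha : 0 < a) (hb : 0 < b)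
    (hW : (Submodule.span ℂ {φ, ψ})ᗮ ≠ ⊥) :
    0 < spectralGap (K : Module.End ℂ G) a b := by
  have hinv := map_mem_span_pair hφ hψ
  have hKc := isCompactOperator_restrictOrthogonal hK hs hinv
  have hKs := isSymmetric_restrictOrthogonal hs hinv
  have hno : ∀ c : ℝ, (c = a ∨ c = b) →
      ¬ HasEigenvalue (restrictOrthogonal hs hinv :
        (Submodule.span ℂ {φ, ψ})ᗮ →ₗ[ℂ] (Submodule.span ℂ {φ, ψ})ᗮ) (c : ℂ) := by
    intro c hc hu
    obtain ⟨x, hx, hx0, hKx⟩ := hasEigenvalue_of_restrictOrthogonal hs hinv hu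
    obtain ⟨h1, h2⟩ := mem_orthogonal_span_pair.1 hx
    refine hx0 (hE x h1 h2 ?_)
    rcases hc with rfl | rfl
    · exact Or.inl hKx
    · exact Or.inr hKx
  have hlow : ∀ c : ℝ, 0 < c → (c = a ∨ c = b) → ∃ g > 0, ∀ u : ℝ, u ≠ a → u ≠ b →
      HasEigenvalue (K : Module.End ℂ G) (u : ℂ) → g ≤ |c - u| := by
    intro c hc0 hc
    obtain ⟨L, hL⟩ := IsCompactOperator.antilipschitz_of_not_hasEigenvalue hKc
      (Complex.ofReal_ne_zero.2 hc0.ne') (hno c hc)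
    obtain ⟨g, hg0, hg⟩ := antilipschitzWith_iff_exists_mul_le_norm.1 ⟨L, hL⟩
    refine ⟨g, hg0, fun u hua hub hu => ?_⟩
    obtain ⟨x, hx⟩ := hu.exists_hasEigenvector
    have hKx : K x = (u : ℂ) • x := hx.apply_eq_smul
    have hxW := mem_orthogonal_of_eigenvector hs hφ hψ hua hub hKx
    have h1 := hg ⟨x, hxW⟩
    have h2 : (((restrictOrthogonal hs hinv - (c : ℂ) • 1) ⟨x, hxW⟩ : _) : G)
        = ((u - c : ℝ) : ℂ) • x := by
      change K x - (c : ℂ) • x = _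
      rw [hKx, Complex.ofReal_sub, sub_smul]
    rw [← Submodule.norm_coe, ← Submodule.norm_coe, h2, norm_smul, Complex.norm_real,
      Real.norm_eq_abs, abs_sub_comm] at h1
    exact le_of_mul_le_mul_right h1 (norm_pos_iff.2 hx.2)
  obtain ⟨g₁, hg₁, h₁⟩ := hlow a ha (Or.inl rfl)
  obtain ⟨g₂, hg₂, h₂⟩ := hlow b hb (Or.inr rfl)
  have : Nontrivial (Submodule.span ℂ {φ, ψ})ᗮ := Submodule.nontrivial_iff_ne_bot.2 hW
  obtain ⟨u, hu⟩ := exists_real_hasEigenvalue hKc hKs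
  have hua : u ≠ a := fun h => hno u (Or.inl h) hu
  have hub : u ≠ b := fun h => hno u (Or.inr h) hu
  obtain ⟨x, hx, hx0, hKx⟩ := hasEigenvalue_of_restrictOrthogonal hs hinv hu
  have hu' : HasEigenvalue (K : Module.End ℂ G) (u : ℂ) :=
    hasEigenvalue_of_hasEigenvector ⟨mem_eigenspace_iff.2 hKx, hx0⟩
  refine lt_of_lt_of_le (lt_min hg₁ hg₂) (le_csInf ?_ ?_)
  · exact ⟨_, u, ⟨hu', by simp [hua, hub]⟩, rfl⟩
  · rintro _ ⟨w, ⟨hw, hw'⟩, rfl⟩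
    simp only [mem_insert_iff, mem_singleton_iff, not_or] at hw'
    exact min_le_min (h₁ w hw'.1 hw'.2 hw) (h₂ w hw'.1 hw'.2 hw)

/-- On the orthogonal complement of `φ`, `ψ` the operator `K - a` is bounded below by the
spectral gap. -/
theorem spectralGap_mul_norm_le
    (hK : IsCompactOperator K) (hs : (K : G →ₗ[ℂ] G).IsSymmetric)
    (hφ : K φ = (a : ℂ) • φ) (hψ : K ψ = (b : ℂ) • ψ)
    (hE : ∀ r, inner ℂ φ r = 0 → inner ℂ ψ r = 0 →
      K r = (a : ℂ) • r ∨ K r = (b : ℂ) • r → r = 0)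
    {r : G} (h1 : inner ℂ φ r = 0) (h2 : inner ℂ ψ r = 0) :
    spectralGap (K : Module.End ℂ G) a b * ‖r‖ ≤ ‖K r - (a : ℂ) • r‖ := by
  have hinv := map_mem_span_pair hφ hψ
  have hKc := isCompactOperator_restrictOrthogonal hK hs hinv
  have hKs := isSymmetric_restrictOrthogonal hs hinv
  have hbdd : ∀ y ∈ (fun u : ℝ => min |a - u| |b - u|) ''
      (realPointSpectrum (K : Module.End ℂ G) \ {a, b}), 0 ≤ y := by
    rintro _ ⟨w, -, rfl⟩
    positivity
  have hnn : 0 ≤ spectralGap (K : Module.End ℂ G) a b := Real.sInf_nonneg hbdd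
  refine mul_norm_le_norm_sub_smul hKc hKs hnn (fun u hu => ?_)
    (⟨r, mem_orthogonal_span_pair.2 ⟨h1, h2⟩⟩ : (Submodule.span ℂ {φ, ψ})ᗮ)
  obtain ⟨w, rfl⟩ := Complex.conj_eq_iff_real.1 (hKs.conj_eigenvalue_eq_self hu)
  obtain ⟨x, hx, hx0, hKx⟩ := hasEigenvalue_of_restrictOrthogonal hs hinv hu
  obtain ⟨hx1, hx2⟩ := mem_orthogonal_span_pair.1 hx
  have hwa : w ≠ a := fun h => hx0 (hE x hx1 hx2 (Or.inl (h ▸ hKx)))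
  have hwb : w ≠ b := fun h => hx0 (hE x hx1 hx2 (Or.inr (h ▸ hKx)))
  have hw' : HasEigenvalue (K : Module.End ℂ G) (w : ℂ) :=
    hasEigenvalue_of_hasEigenvector ⟨mem_eigenspace_iff.2 hKx, hx0⟩
  have hle : spectralGap (K : Module.End ℂ G) a b ≤ min |a - w| |b - w| :=
    csInf_le ⟨0, hbdd⟩ ⟨w, ⟨hw', by simp [hwa, hwb]⟩, rfl⟩
  rw [← Complex.ofReal_sub, Complex.norm_real, Real.norm_eq_abs, abs_sub_comm]
  exact hle.trans (min_le_left _ _)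

end Gap

section UnitaryGroup

variable {G : Type*} [NormedAddCommGroup G] [InnerProductSpace ℂ G]
  {U : ℝ → G →ₗᵢ[ℂ] G} {f f' g g' : G}

theorem hasDerivAt_orbit (hU : ∀ s t f, U (s + t) f = U s (U t f))
    (hf : HasDerivAt (fun t => U t f) f' 0) (t : ℝ) :
    HasDerivAt (fun t => U t f) (U t f') t := by
  have h1 : HasDerivAt (fun s => U (s - t) f) f' t := by
    have : HasDerivAt (fun t => U t f) f' (t - t) := by simpa using hf
    exact this.comp_sub_const t t
  have h2 := ((U t).toContinuousLinearMap.restrictScalars ℝ).hasFDerivAt.comp_hasDerivAt t h1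
  refine h2.congr_of_eventuallyEq (Eventually.of_forall fun s => ?_)
  simp [← hU]

/-- If `f` is nearly an eigenvector of the generator, its orbit nearly rotates. -/
theorem norm_orbit_sub_exp_smul_le (h0 : ∀ f, U 0 f = f)
    (hU : ∀ s t f, U (s + t) f = U s (U t f))
    (hf : HasDerivAt (fun t => U t f) f' 0) (ω : ℝ) {t : ℝ} (ht : 0 ≤ t) :
    ‖U t f - Complex.exp (Complex.I * ω * t) • f‖ ≤ ‖f' - (Complex.I * ω) • f‖ * t := by
  have hexp : ∀ s : ℝ, ‖Complex.exp (-(Complex.I * ω * s))‖ = 1 := fun s => by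
    rw [Complex.norm_exp]; simp
  have hd : ∀ s : ℝ, HasDerivAt (fun s : ℝ => Complex.exp (-(Complex.I * ω * s)) • U s f)
      (Complex.exp (-(Complex.I * ω * s)) • U s (f' - (Complex.I * ω) • f)) s := by
    intro s
    have he : HasDerivAt (fun s : ℝ => Complex.exp (-(Complex.I * ω * s)))
        (Complex.exp (-(Complex.I * ω * s)) * (-(Complex.I * ω * 1))) s :=
      (((hasDerivAt_id (s : ℂ)).const_mul (Complex.I * ω)).neg.cexp).comp_ofReal
    have := he.smul (hasDerivAt_orbit hU hf s)
    refine HasDerivAt.congr_deriv this ?_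
    rw [map_sub, map_smul, smul_sub, smul_smul, mul_one, mul_neg, neg_smul]
    abel
  have := norm_image_sub_le_of_norm_deriv_le_segment' (a := 0) (b := t)
    (fun s _ => (hd s).hasDerivWithinAt) (C := ‖f' - (Complex.I * ω) • f‖)
    (fun s _ => by rw [norm_smul, hexp, one_mul, LinearIsometry.norm_map]) t ⟨ht, le_rfl⟩
  have heq : U t f - Complex.exp (Complex.I * ω * t) • f = Complex.exp (Complex.I * ω * t) •
      (Complex.exp (-(Complex.I * ω * t)) • U t f - f) := by
    rw [smul_sub, smul_smul, ← Complex.exp_add]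
    simp
  have hn : ‖Complex.exp (Complex.I * ω * t)‖ = 1 := by rw [Complex.norm_exp]; simp
  rw [heq, norm_smul, hn, one_mul]
  simpa [h0] using this

theorem inner_deriv_eq_neg (h0 : ∀ f, U 0 f = f) (hf : HasDerivAt (fun t => U t f) f' 0)
    (hg : HasDerivAt (fun t => U t g) g' 0) :
    (inner ℂ f g' : ℂ) = -inner ℂ f' g := by
  have h1 := HasDerivAt.inner ℂ hf hg
  have h2 : HasDerivAt (fun t => (inner ℂ (U t f) (U t g) : ℂ)) 0 0 := by
    simp only [LinearIsometry.inner_map_map]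
    exact hasDerivAt_const _ _
  have := h1.unique h2
  rw [h0, h0] at this
  exact eq_neg_of_add_eq_zero_left this

theorem hasDerivAt_inner_orbit (hg : HasDerivAt (fun t => U t g) g' 0) (f : G) :
    HasDerivAt (fun t => (inner ℂ f (U t g) : ℂ)) (inner ℂ f g') 0 := by
  simpa using HasDerivAt.inner ℂ (hasDerivAt_const (0 : ℝ) f) hg

theorem im_inner_deriv_eq_zero (hg : HasDerivAt (fun t => U t g) g' 0)
    (h : ∀ t, (inner ℂ f (U t g) : ℂ).im = 0) : (inner ℂ f g' : ℂ).im = 0 := by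
  have h1 := Complex.imCLM.hasFDerivAt.comp_hasDerivAt (0 : ℝ) (hasDerivAt_inner_orbit hg f)
  have h2 : HasDerivAt (Complex.imCLM ∘ fun t => (inner ℂ f (U t g) : ℂ)) 0 0 := by
    have : (Complex.imCLM ∘ fun t => (inner ℂ f (U t g) : ℂ)) = fun _ => 0 := by
      funext t; exact h t
    rw [this]
    exact hasDerivAt_const _ _
  exact h1.unique h2

/-- If `K` nearly commutes with the unitary group, then `(K - a)` applied to the derivative of an
orbit is controlled by the derivative of the orbit of `w = (K - a) f`. -/
theorem norm_sub_smul_deriv_le (h0 : ∀ f, U 0 f = f) {K : G →L[ℂ] G} {c : ℝ}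
    (hc : ∀ t f, ‖K (U t f) - U t (K f)‖ ≤ c * |t| * ‖f‖)
    (hf : HasDerivAt (fun t => U t f) f' 0) {a : ℂ} {w w' : G} (hw : K f = a • f + w)
    (hw' : HasDerivAt (fun t => U t w) w' 0) (hc0 : 0 ≤ c) :
    ‖K f' - a • f'‖ ≤ c * ‖f‖ + ‖w'‖ := by
  have h1 := (K.restrictScalars ℝ).hasFDerivAt.comp_hasDerivAt (0 : ℝ) hf
  have h2 := (h1.sub (hf.const_smul a)).sub hw'
  have h3 : ‖K f' - a • f' - w'‖ ≤ c * ‖f‖ := by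
    refine HasDerivAt.le_of_lip' h2 (by positivity) (Eventually.of_forall fun t => ?_)
    have := hc t f
    rw [hw, map_add, map_smul] at this
    simp only [Pi.sub_apply, Function.comp_apply, ContinuousLinearMap.coe_restrictScalars',
      Pi.smul_apply, h0, hw, sub_zero]
    rw [show a • f + w - a • f - w = 0 by abel, sub_zero, sub_sub, Real.norm_eq_abs]
    linarith
  calc ‖K f' - a • f'‖ = ‖(K f' - a • f' - w') + w'‖ := by rw [sub_add_cancel]
    _ ≤ _ := (norm_add_le _ _).trans (by gcongr)

end UnitaryGroup

section TwoLevel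

variable {G : Type*} [NormedAddCommGroup G] [InnerProductSpace ℂ G]
  {U : ℝ → G →ₗᵢ[ℂ] G} {φ ψ φ' ψ' : G}

theorem ofReal_inv_sqrt_two_sq :
    ((1 / Real.sqrt 2 : ℝ) : ℂ) * ((1 / Real.sqrt 2 : ℝ) : ℂ) = 1 / 2 := by
  rw [← Complex.ofReal_mul, div_mul_div_comm, Real.mul_self_sqrt (by norm_num)]
  norm_num

theorem norm_combination_eq_one (hφ1 : ‖φ‖ = 1) (hψ1 : ‖ψ‖ = 1) (hφψ : inner ℂ φ ψ = 0) :
    ‖((1 / Real.sqrt 2 : ℝ) : ℂ) • (φ + Complex.I • ψ)‖ = 1 := by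
  have h : ‖φ + Complex.I • ψ‖ * ‖φ + Complex.I • ψ‖ = 2 := by
    rw [norm_add_sq_eq_norm_sq_add_norm_sq_of_inner_eq_zero (𝕜 := ℂ) _ _
      (by rw [inner_smul_right, hφψ, mul_zero]), norm_smul, hφ1, hψ1]
    norm_num
  have h2 : ‖φ + Complex.I • ψ‖ = Real.sqrt 2 := by
    rw [← h, Real.sqrt_mul_self (norm_nonneg _)]
  rw [norm_smul, h2, Complex.norm_real, Real.norm_of_nonneg (by positivity)]
  field_simp

/-- The residual of `z = (φ + iψ)/√2` as an approximate eigenvector of the generator. -/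
theorem gap_mul_norm_residual_le (h0 : ∀ f, U 0 f = f) {K : G →L[ℂ] G} {c g a b ω : ℝ}
    (hc0 : 0 ≤ c) (hc : ∀ t f, ‖K (U t f) - U t (K f)‖ ≤ c * |t| * ‖f‖)
    (hs : (K : G →ₗ[ℂ] G).IsSymmetric)
    (hφ : K φ = (a : ℂ) • φ) (hψ : K ψ = (b : ℂ) • ψ) (hab : a ≤ b)
    (hφ1 : ‖φ‖ = 1) (hψ1 : ‖ψ‖ = 1) (hφψ : inner ℂ φ ψ = 0)
    (hφ' : HasDerivAt (fun t => U t φ) φ' 0) (hψ' : HasDerivAt (fun t => U t ψ) ψ' 0)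
    (hφφ' : inner ℂ φ φ' = 0) (hψψ' : inner ℂ ψ ψ' = 0)
    (hφψ' : inner ℂ φ ψ' = (ω : ℂ)) (hψφ' : inner ℂ ψ φ' = -(ω : ℂ))
    (hg : ∀ r, inner ℂ φ r = 0 → inner ℂ ψ r = 0 → g * ‖r‖ ≤ ‖K r - (a : ℂ) • r‖) :
    g * ‖((1 / Real.sqrt 2 : ℝ) : ℂ) • (φ' + Complex.I • ψ') -
      (Complex.I * ω) • ((1 / Real.sqrt 2 : ℝ) : ℂ) • (φ + Complex.I • ψ)‖
      ≤ c + 1 / Real.sqrt 2 * (b - a) * ‖ψ'‖ := by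
  set q : ℂ := ((1 / Real.sqrt 2 : ℝ) : ℂ) with hq
  set z := q • (φ + Complex.I • ψ) with hz
  set z' := q • (φ' + Complex.I • ψ') with hz'
  set r := z' - (Complex.I * ω) • z with hr
  have hψφ : inner ℂ ψ φ = 0 := inner_eq_zero_symm.1 hφψ
  have hφφ : (inner ℂ φ φ : ℂ) = 1 := by rw [inner_self_eq_norm_sq_to_K, hφ1]; simp
  have hψψ : (inner ℂ ψ ψ : ℂ) = 1 := by rw [inner_self_eq_norm_sq_to_K, hψ1]; simp
  have h1 : inner ℂ φ r = 0 := by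
    simp only [hr, hz, hz', inner_sub_right, inner_smul_right, inner_add_right, hφφ', hφψ', hφφ,
      hφψ]
    ring
  have h2 : inner ℂ ψ r = 0 := by
    simp only [hr, hz, hz', inner_sub_right, inner_smul_right, inner_add_right, hψφ', hψψ', hψψ,
      hψφ]
    linear_combination (-(q * ω)) * Complex.I_mul_I
  refine (hg r h1 h2).trans ?_
  have hKz : K z = (a : ℂ) • z + (q * Complex.I * (b - a)) • ψ := by
    rw [hz, map_smul, map_add, map_smul, hφ, hψ]
    module
  have hz1 : ‖z‖ = 1 := norm_combination_eq_one hφ1 hψ1 hφψ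
  have hdz : HasDerivAt (fun t => U t z) z' 0 := by
    have := (hφ'.add (hψ'.const_smul Complex.I)).const_smul q
    refine this.congr_of_eventuallyEq (Eventually.of_forall fun t => ?_)
    simp [hz]
  have hdw : HasDerivAt (fun t => U t ((q * Complex.I * (b - a)) • ψ))
      ((q * Complex.I * (b - a)) • ψ') 0 := by
    simpa using! hψ'.const_smul (q * Complex.I * (b - a))
  have key := norm_sub_smul_deriv_le h0 hc hdz hKz hdw hc0
  have hnw : ‖(q * Complex.I * (b - a)) • ψ'‖ = 1 / Real.sqrt 2 * (b - a) * ‖ψ'‖ := by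
    rw [norm_smul, norm_mul, norm_mul, Complex.norm_I, mul_one, hq, ← Complex.ofReal_sub,
      Complex.norm_real, Complex.norm_real, Real.norm_of_nonneg (by positivity),
      Real.norm_of_nonneg (by linarith)]
  rw [hz1, mul_one, hnw] at key
  refine le_trans ?_ key
  -- `(K - a) z'` is the orthogonal sum of `(K - a) r` and a multiple of `ψ`
  have hsplit : K z' - (a : ℂ) • z' = (K r - (a : ℂ) • r) +
      (Complex.I * ω * (q * Complex.I * (b - a))) • ψ := by
    have : z' = r + (Complex.I * ω) • z := by rw [hr]; abel
    rw [this, map_add, map_smul, hKz]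
    module
  have horth : inner ℂ (K r - (a : ℂ) • r)
      ((Complex.I * ω * (q * Complex.I * (b - a))) • ψ) = 0 := by
    have h3 : inner ℂ (K r) ψ = inner ℂ r (K ψ) := hs r ψ
    have h4 : inner ℂ r ψ = 0 := inner_eq_zero_symm.1 h2
    rw [inner_smul_right, inner_sub_left, h3, hψ, inner_smul_left, inner_smul_right, h4]
    simp
  rw [hsplit]
  have := norm_add_sq_eq_norm_sq_add_norm_sq_of_inner_eq_zero (𝕜 := ℂ) _ _ horth
  nlinarith [norm_nonneg (K r - (a : ℂ) • r), norm_nonneg ((K r - (a : ℂ) • r) +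
      (Complex.I * ω * (q * Complex.I * (b - a))) • ψ),
      mul_self_nonneg ‖(Complex.I * ω * (q * Complex.I * (b - a))) • ψ‖]

/-- The error bound: a quantity bounded both by `2` and by the linear growth `R t` of the residual
is bounded by `s + 3 √S`. -/
theorem le_add_three_mul_sqrt {e R g c T δ A t : ℝ} (hg : 0 < g) (hc : 0 ≤ c) (hT : 0 < T)
    (hδ : 0 ≤ δ) (hA : 0 ≤ A) (ht : 0 ≤ t) (h2 : e ≤ 2) (hR : e ≤ R * t)
    (hgR : g * R ≤ c / (2 * T) + δ * A) :
    e ≤ 1 / g * (c * t / T + 3 * δ) +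
      3 * Real.sqrt (A * ∫ u in (0 : ℝ)..t, 1 / g * (c * u / T + 3 * δ)) := by
  have hint : ∫ u in (0 : ℝ)..t, 1 / g * (c * u / T + 3 * δ)
      = 1 / g * (c / T * (t ^ 2 / 2) + 3 * δ * t) := by
    have : ∀ u : ℝ, 1 / g * (c * u / T + 3 * δ) = 1 / g * (c / T * u + 3 * δ) := fun u => by ring
    simp only [this]
    rw [intervalIntegral.integral_const_mul, intervalIntegral.integral_add
      ((by fun_prop : Continuous fun u : ℝ => c / T * u).intervalIntegrable _ _)
      (continuous_const.intervalIntegrable _ _), intervalIntegral.integral_const_mul,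
      integral_id, intervalIntegral.integral_const]
    simp only [smul_eq_mul, sub_zero]
    ring
  rw [hint]
  set S := A * (1 / g * (c / T * (t ^ 2 / 2) + 3 * δ * t)) with hS
  have hs0 : 0 ≤ 1 / g * (c * t / T + 3 * δ) := by positivity
  have hS0 : 0 ≤ S := by positivity
  have hsq := Real.sq_sqrt hS0
  have hsn := Real.sqrt_nonneg S
  by_cases h1 : 1 ≤ Real.sqrt S
  · linarith
  · push Not at h1
    have hR' : R ≤ 1 / g * (c / (2 * T) + δ * A) := by
      rw [one_div, inv_mul_eq_div, le_div_iff₀ hg]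
      linarith
    have h3 : R * t ≤ 1 / g * (c / (2 * T) + δ * A) * t := by gcongr
    have h4 : 1 / g * (c / (2 * T) + δ * A) * t ≤ 1 / g * (c * t / T + 3 * δ) + S := by
      have e1 : 1 / g * (c * t / T + 3 * δ) + S - 1 / g * (c / (2 * T) + δ * A) * t
          = 1 / g * (c * t / T / 2) + 1 / g * (3 * δ) + A * (1 / g * (c / T * (t ^ 2 / 2)))
            + 2 * (1 / g * (δ * A * t)) := by
        rw [hS]; field_simp; ring
      have e2 : 0 ≤ 1 / g * (c * t / T / 2) + 1 / g * (3 * δ) +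
          A * (1 / g * (c / T * (t ^ 2 / 2))) + 2 * (1 / g * (δ * A * t)) := by positivity
      linarith
    nlinarith

end TwoLevel

section Lp

variable {Ω : Type*} [MeasurableSpace Ω] {μ : Measure Ω} [IsProbabilityMeasure μ]

theorem norm_Lp_le_of_ae_bound {f : Lp ℂ 2 μ} {C : ℝ} (hC : 0 ≤ C) (h : ∀ᵐ x ∂μ, ‖f x‖ ≤ C) :
    ‖f‖ ≤ C := by
  have := Lp.norm_le_of_ae_bound hC h
  simpa [measureUnivNNReal] using this

theorem integral_norm_le_norm_Lp (f : Lp ℂ 2 μ) : ∫ x, ‖f x‖ ∂μ ≤ ‖f‖ := by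
  have h := eLpNorm_le_eLpNorm_of_exponent_le (p := 1) (q := 2) (by norm_num)
    (Lp.aestronglyMeasurable f)
  rw [Lp.norm_def, integral_norm_eq_lintegral_enorm (Lp.aestronglyMeasurable f),
    ← eLpNorm_one_eq_lintegral_enorm]
  exact ENNReal.toReal_mono (Lp.eLpNorm_ne_top f) h

/-- A kernel that is bounded by `C` almost everywhere defines functions bounded by `C ‖f‖`. -/
theorem norm_integral_mul_le {f : Lp ℂ 2 μ} {a : Ω → ℂ} {C : ℝ} (h : ∀ᵐ y ∂μ, ‖a y‖ ≤ C)
    (hf : Integrable f μ) :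
    ‖∫ y, a y * f y ∂μ‖ ≤ C * ‖f‖ := by
  have hC : 0 ≤ C := by
    obtain ⟨y, hy⟩ := h.exists
    exact (norm_nonneg _).trans hy
  calc ‖∫ y, a y * f y ∂μ‖ ≤ ∫ y, C * ‖f y‖ ∂μ := by
        refine norm_integral_le_of_norm_le (hf.norm.const_mul C) ?_
        filter_upwards [h] with y hy
        rw [norm_mul]
        gcongr
    _ = C * ∫ y, ‖f y‖ ∂μ := integral_const_mul _ _
    _ ≤ C * ‖f‖ := by gcongr; exact integral_norm_le_norm_Lp f

theorem norm_Lp_sq_eq_integral (f : Lp ℂ 2 μ) : ‖f‖ ^ 2 = ∫ x, ‖f x‖ ^ 2 ∂μ := by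
  have h : (inner ℂ f f : ℂ) = ∫ x, ((‖f x‖ ^ 2 : ℝ) : ℂ) ∂μ := by
    rw [L2.inner_def]
    refine integral_congr_ae (Eventually.of_forall fun x => ?_)
    simp only [inner_self_eq_norm_sq_to_K, Complex.ofReal_pow]
    rfl
  rw [← inner_self_eq_norm_sq (𝕜 := ℂ) f, h, integral_complex_ofReal]
  rfl

end Lp

section Flow

variable {Ω : Type*} [MetricSpace Ω] [MeasurableSpace Ω] [BorelSpace Ω]
  {Φ : Flow ℝ Ω} {μ : Measure Ω}

theorem coeFn_koopman (hinv : IsInvariant Φ μ) (t : ℝ) (f : Lp ℂ 2 μ) :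
    koopman Φ hinv t f =ᵐ[μ] fun x => f (Φ t x) :=
  Lp.coeFn_compMeasurePreserving f (hinv t)

theorem koopman_toLp (hinv : IsInvariant Φ μ) (t : ℝ) {g : Ω → ℂ} (hg : MemLp g 2 μ) :
    koopman Φ hinv t (hg.toLp g) = (hg.comp_measurePreserving (hinv t)).toLp _ :=
  rfl

theorem koopman_zero (hinv : IsInvariant Φ μ) (f : Lp ℂ 2 μ) : koopman Φ hinv 0 f = f := by
  refine Lp.ext ?_
  filter_upwards [coeFn_koopman hinv 0 f] with x hx
  rw [hx, Φ.map_zero_apply]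

theorem koopman_add (hinv : IsInvariant Φ μ) (s t : ℝ) (f : Lp ℂ 2 μ) :
    koopman Φ hinv (s + t) f = koopman Φ hinv s (koopman Φ hinv t f) := by
  refine Lp.ext ?_
  filter_upwards [coeFn_koopman hinv (s + t) f, coeFn_koopman hinv s (koopman Φ hinv t f),
    (hinv s).quasiMeasurePreserving.ae (coeFn_koopman hinv t f)] with x h1 h2 h3
  rw [h1, h2, h3, add_comm, Φ.map_add]

/-- The integral of a function is invariant under the flow. -/
theorem integral_comp_flow (hinv : IsInvariant Φ μ) (t : ℝ) (g : Ω → ℂ) :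
    ∫ x, g (Φ t x) ∂μ = ∫ x, g x ∂μ :=
  (hinv t).integral_comp (Φ.toHomeomorph t).measurableEmbedding g

/-- The support of an invariant measure is invariant. -/
theorem map_mem_support (hinv : IsInvariant Φ μ) (t : ℝ) {x : Ω} (hx : x ∈ μ.support) :
    Φ t x ∈ μ.support := by
  rw [Measure.mem_support_iff_forall] at hx ⊢
  intro U hU
  have h1 : Φ t ⁻¹' U ∈ 𝓝 x := (Φ.continuous_toFun t).continuousAt hU
  refine (hx _ h1).trans_le ?_
  rw [← (hinv t).measure_preimage_emb (Φ.toHomeomorph t).measurableEmbedding U]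

theorem ae_mem_support (hμX : μ μ.supportᶜ = 0) : ∀ᵐ x ∂μ, x ∈ μ.support := by
  rw [ae_iff]; exact hμX

end Flow

section Kernel

variable {Ω : Type*} [MetricSpace Ω] [MeasurableSpace Ω] [BorelSpace Ω]
  {μ : Measure Ω} [IsProbabilityMeasure μ]

theorem coeFn_kernelOp (k : Ω × Ω →ᵇ ℝ) (f : Lp ℂ 2 μ) :
    kernelOp μ k f =ᵐ[μ] kernelIntegral μ k f :=
  (memLp_kernelIntegral k (integrable_of_Lp f)).coeFn_toLp

theorem norm_kernelOp_apply_le (k : Ω × Ω →ᵇ ℝ) (f : Lp ℂ 2 μ) :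
    ‖kernelOp μ k f‖ ≤ ‖k‖ * ‖f‖ := by
  refine norm_Lp_le_of_ae_bound (by positivity) ?_
  filter_upwards [coeFn_kernelOp k f] with x hx
  rw [hx]
  refine norm_integral_mul_le (Eventually.of_forall fun y => ?_) (integrable_of_Lp f)
  rw [Complex.norm_real]
  exact k.norm_coe_le_norm _

/-- The kernel integral operator as a bounded operator. -/
noncomputable def kernelCLM (μ : Measure Ω) [IsProbabilityMeasure μ] (k : Ω × Ω →ᵇ ℝ) :
    Lp ℂ 2 μ →L[ℂ] Lp ℂ 2 μ :=
  (kernelOp μ k).mkContinuous ‖k‖ (norm_kernelOp_apply_le k)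

/-- The operator with kernel `k (σ x, σ y)` for a simple function `σ`. -/
noncomputable def simpleKernelCLM (μ : Measure Ω) [IsProbabilityMeasure μ] (k : Ω × Ω →ᵇ ℝ)
    (σ : SimpleFunc Ω Ω) : Lp ℂ 2 μ →L[ℂ] Lp ℂ 2 μ :=
  ∑ c ∈ σ.range, ∑ d ∈ σ.range, (k (c, d) : ℂ) •
    (innerSL ℂ (indicatorConstLp 2 (σ.measurableSet_fiber d) (measure_ne_top μ _) (1 : ℂ))).smulRight
      (indicatorConstLp 2 (σ.measurableSet_fiber c) (measure_ne_top μ _) (1 : ℂ))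

theorem isCompactOperator_simpleKernelCLM (k : Ω × Ω →ᵇ ℝ) (σ : SimpleFunc Ω Ω) :
    IsCompactOperator (simpleKernelCLM μ k σ) := by
  have : simpleKernelCLM μ k σ ∈ compactOperator (RingHom.id ℂ) (Lp ℂ 2 μ) (Lp ℂ 2 μ) := by
    unfold simpleKernelCLM
    refine Submodule.sum_mem _ fun c _ => Submodule.sum_mem _ fun d _ => Submodule.smul_mem _ _ ?_
    exact (isCompactOperator_of_locallyCompactSpace_rng
      (ContinuousLinearMap.smulRight (1 : ℂ →L[ℂ] ℂ)
        (indicatorConstLp 2 (σ.measurableSet_fiber c) (measure_ne_top μ _) (1 : ℂ)))).comp_clm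
      (innerSL ℂ (indicatorConstLp 2 (σ.measurableSet_fiber d) (measure_ne_top μ _) (1 : ℂ)))
  exact this

theorem inner_simpleKernelCLM {k : Ω × Ω →ᵇ ℝ} (hk : ∀ x y, k (x, y) = k (y, x))
    (σ : SimpleFunc Ω Ω) (f g : Lp ℂ 2 μ) :
    inner ℂ (simpleKernelCLM μ k σ f) g = inner ℂ f (simpleKernelCLM μ k σ g) := by
  simp only [simpleKernelCLM, sum_apply, smul_apply,
    ContinuousLinearMap.smulRight_apply, innerSL_apply_apply, sum_inner, inner_sum,
    inner_smul_left, inner_smul_right, Complex.conj_ofReal, inner_conj_symm]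
  rw [Finset.sum_comm]
  refine Finset.sum_congr rfl fun c _ => Finset.sum_congr rfl fun d _ => ?_
  rw [hk]
  ring

theorem coeFn_simpleKernelCLM (k : Ω × Ω →ᵇ ℝ) (σ : SimpleFunc Ω Ω) (f : Lp ℂ 2 μ) :
    simpleKernelCLM μ k σ f =ᵐ[μ] fun x => ∫ y, (k (σ x, σ y) : ℂ) * f y ∂μ := by
  have h1 : ∀ c ∈ σ.range, ∀ᵐ x ∂μ,
      (indicatorConstLp 2 (σ.measurableSet_fiber c) (measure_ne_top μ _) (1 : ℂ) : Lp ℂ 2 μ) x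
        = (σ ⁻¹' {c}).indicator (fun _ => (1 : ℂ)) x := fun c _ => indicatorConstLp_coeFn
  have h2 := (Finset.eventually_all σ.range).2 h1
  have hint : ∀ d, Integrable ((σ ⁻¹' {d}).indicator f) μ := fun d =>
    (integrable_of_Lp f).indicator (σ.measurableSet_fiber d)
  have hsum : simpleKernelCLM μ k σ f = ∑ c ∈ σ.range, (∑ d ∈ σ.range,
      (k (c, d) : ℂ) * ∫ y in σ ⁻¹' {d}, f y ∂μ) •
      (indicatorConstLp 2 (σ.measurableSet_fiber c) (measure_ne_top μ _) (1 : ℂ) : Lp ℂ 2 μ) := by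
    simp only [simpleKernelCLM, sum_apply, smul_apply,
      ContinuousLinearMap.smulRight_apply, innerSL_apply_apply, Finset.sum_smul, mul_smul,
      L2.inner_indicatorConstLp_one]
  rw [hsum]
  have h3 : ∀ a : Ω → ℂ, ∀ᵐ x ∂μ, (∑ c ∈ σ.range, a c • (indicatorConstLp 2
      (σ.measurableSet_fiber c) (measure_ne_top μ _) (1 : ℂ) : Lp ℂ 2 μ) : Lp ℂ 2 μ) x
      = ∑ c ∈ σ.range, a c * (indicatorConstLp 2
      (σ.measurableSet_fiber c) (measure_ne_top μ _) (1 : ℂ) : Lp ℂ 2 μ) x := by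
    intro a
    have hs : ∀ c ∈ σ.range, ∀ᵐ x ∂μ, (a c • (indicatorConstLp 2
      (σ.measurableSet_fiber c) (measure_ne_top μ _) (1 : ℂ) : Lp ℂ 2 μ) : Lp ℂ 2 μ) x =
      a c * (indicatorConstLp 2
      (σ.measurableSet_fiber c) (measure_ne_top μ _) (1 : ℂ) : Lp ℂ 2 μ) x := fun c _ =>
      Lp.coeFn_smul _ _
    filter_upwards [Lp.coeFn_finsetSum σ.range fun c => (a c • (indicatorConstLp 2
      (σ.measurableSet_fiber c) (measure_ne_top μ _) (1 : ℂ) : Lp ℂ 2 μ) : Lp ℂ 2 μ),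
      (Finset.eventually_all σ.range).2 hs] with x hx hx'
    rw [hx, Finset.sum_apply]
    exact Finset.sum_congr rfl hx'
  filter_upwards [h2, h3 _] with x hx hx'
  rw [hx', Finset.sum_eq_single (σ x)]
  · rw [hx _ (σ.mem_range_self x), indicator_of_mem (by simp), mul_one]
    have : ∀ y, (k (σ x, σ y) : ℂ) * f y =
        ∑ d ∈ σ.range, (k (σ x, d) : ℂ) * (σ ⁻¹' {d}).indicator f y := by
      intro y
      rw [Finset.sum_eq_single (σ y)]
      · rw [indicator_of_mem (by simp)]
      · intro d _ hd
        rw [indicator_of_notMem (by simpa using hd.symm), mul_zero]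
      · intro h; exact absurd (σ.mem_range_self y) h
    simp only [this]
    rw [integral_finsetSum _ fun d _ => (hint d).const_mul _]
    refine Finset.sum_congr rfl fun d _ => ?_
    rw [integral_const_mul, integral_indicator (σ.measurableSet_fiber d)]
  · intro c hc hcx
    rw [hx c hc, indicator_of_notMem (by simpa using hcx.symm), mul_zero]
  · intro h; exact absurd (σ.mem_range_self x) h

/-- A continuous kernel is uniformly approximated on a compact set by simple kernels. -/
theorem exists_simpleFunc_dist_kernel_le (k : Ω × Ω →ᵇ ℝ) {X : Set Ω} (hX : IsCompact X)
    (hX0 : X.Nonempty) {ε : ℝ} (hε : 0 < ε) :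
    ∃ σ : SimpleFunc Ω Ω, ∀ x ∈ X, ∀ y ∈ X, |k (x, y) - k (σ x, σ y)| ≤ ε := by
  have huc := (hX.prod hX).uniformContinuousOn_of_continuous k.continuous.continuousOn
  obtain ⟨δ, hδ, hk⟩ := Metric.uniformContinuousOn_iff_le.1 huc ε hε
  obtain ⟨t, htX, htf, htc⟩ := hX.finite_cover_balls hδ
  obtain ⟨x₀, hx₀⟩ := hX0
  let l := htf.toFinset.toList
  let e : ℕ → Ω := fun n => l.getD n x₀
  have heX : ∀ n, e n ∈ X := by
    intro n
    by_cases hn : n < l.length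
    · have : e n = l[n] := List.getD_eq_getElem _ _ hn
      rw [this]
      have h1 : l[n] ∈ l := List.getElem_mem hn
      exact htX (htf.mem_toFinset.1 (Finset.mem_toList.1 h1))
    · have : e n = x₀ := List.getD_eq_default _ _ (not_lt.1 hn)
      rwa [this]
  let σ := SimpleFunc.nearestPt e l.length
  have hσX : ∀ x, σ x ∈ X := fun x => by
    change (SimpleFunc.nearestPt e l.length) x ∈ X
    rw [SimpleFunc.nearestPt, SimpleFunc.map_apply]
    exact heX _
  have hσ : ∀ x ∈ X, dist x (σ x) ≤ δ := by
    intro x hx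
    obtain ⟨c, hct, hxc⟩ := mem_iUnion₂.1 (htc hx)
    have hcl : c ∈ l := by simpa [l] using hct
    obtain ⟨n, hn, rfl⟩ := List.getElem_of_mem hcl
    have h1 := SimpleFunc.edist_nearestPt_le e x (k := n) (N := l.length) hn.le
    have h2 : e n = l[n] := List.getD_eq_getElem _ _ hn
    rw [h2, edist_dist, edist_dist, ENNReal.ofReal_le_ofReal_iff dist_nonneg] at h1
    rw [dist_comm]
    refine h1.trans ?_
    rw [dist_comm]
    exact (Metric.mem_ball.1 hxc).le
  refine ⟨σ, fun x hx y hy => ?_⟩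
  rw [← Real.dist_eq]
  exact hk (x, y) ⟨hx, hy⟩ (σ x, σ y) ⟨hσX x, hσX y⟩
    (by rw [Prod.dist_eq]; exact max_le (hσ x hx) (hσ y hy))

theorem norm_kernelCLM_sub_simpleKernelCLM_le (hμX : μ μ.supportᶜ = 0) (k : Ω × Ω →ᵇ ℝ)
    {σ : SimpleFunc Ω Ω} {ε : ℝ} (hε : 0 ≤ ε)
    (hσ : ∀ x ∈ μ.support, ∀ y ∈ μ.support, |k (x, y) - k (σ x, σ y)| ≤ ε) :
    ‖kernelCLM μ k - simpleKernelCLM μ k σ‖ ≤ ε := by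
  refine ContinuousLinearMap.opNorm_le_bound _ hε fun f => ?_
  refine norm_Lp_le_of_ae_bound (by positivity) ?_
  rw [sub_apply]
  filter_upwards [Lp.coeFn_sub (kernelCLM μ k f) (simpleKernelCLM μ k σ f), coeFn_kernelOp k f,
    coeFn_simpleKernelCLM k σ f, ae_mem_support hμX] with x h1 h2 h3 hx
  have h2' : kernelCLM μ k f x = kernelIntegral μ k f x := h2
  have hf := integrable_of_Lp f
  have hi : Integrable (fun y => (k (σ x, σ y) : ℂ) * f y) μ := by
    refine (hf.norm.const_mul ‖k‖).mono' ?_ (Eventually.of_forall fun y => ?_)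
    · refine AEStronglyMeasurable.mul ?_ hf.1
      have hmap : (fun y => (k (σ x, σ y) : ℂ)) = σ.map fun d => (k (σ x, d) : ℂ) := rfl
      rw [hmap]
      exact (SimpleFunc.stronglyMeasurable _).aestronglyMeasurable
    · rw [norm_mul, Complex.norm_real]
      exact mul_le_mul_of_nonneg_right (k.norm_coe_le_norm _) (norm_nonneg _)
  rw [h1, Pi.sub_apply, h2', h3, kernelIntegral,
    ← integral_sub (integrable_kernel_mul k hf x) hi]
  simp only [← sub_mul]
  refine norm_integral_mul_le ?_ hf
  filter_upwards [ae_mem_support hμX] with y hy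
  rw [← Complex.ofReal_sub, Complex.norm_real]
  exact hσ x hx y hy

theorem exists_tendsto_simpleKernelCLM (hX : IsCompact μ.support) (hμX : μ μ.supportᶜ = 0)
    (k : Ω × Ω →ᵇ ℝ) :
    ∃ σ : ℕ → SimpleFunc Ω Ω,
      Tendsto (fun n => simpleKernelCLM μ k (σ n)) atTop (𝓝 (kernelCLM μ k)) := by
  have hX0 : μ.support.Nonempty := (ae_mem_support hμX).exists
  have h : ∀ n : ℕ, ∃ σ : SimpleFunc Ω Ω,
      ‖kernelCLM μ k - simpleKernelCLM μ k σ‖ ≤ 1 / ((n : ℝ) + 1) := by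
    intro n
    have hn : (0 : ℝ) < 1 / ((n : ℝ) + 1) := by positivity
    obtain ⟨σ, hσ⟩ := exists_simpleFunc_dist_kernel_le k hX hX0 hn
    exact ⟨σ, norm_kernelCLM_sub_simpleKernelCLM_le hμX k hn.le hσ⟩
  choose σ hσ using h
  refine ⟨σ, tendsto_iff_norm_sub_tendsto_zero.2 ?_⟩
  refine squeeze_zero (fun _ => norm_nonneg _) (fun n => ?_) tendsto_one_div_add_atTop_nhds_zero_nat
  rw [norm_sub_rev]
  exact hσ n

theorem isCompactOperator_kernelCLM (hX : IsCompact μ.support) (hμX : μ μ.supportᶜ = 0)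
    (k : Ω × Ω →ᵇ ℝ) : IsCompactOperator (kernelCLM μ k) := by
  obtain ⟨σ, hσ⟩ := exists_tendsto_simpleKernelCLM hX hμX k
  exact isCompactOperator_of_tendsto hσ
    (Eventually.of_forall fun n => isCompactOperator_simpleKernelCLM k (σ n))

theorem isSymmetric_kernelCLM (hX : IsCompact μ.support) (hμX : μ μ.supportᶜ = 0)
    {k : Ω × Ω →ᵇ ℝ} (hk : ∀ x y, k (x, y) = k (y, x)) :
    (kernelCLM μ k : Lp ℂ 2 μ →ₗ[ℂ] Lp ℂ 2 μ).IsSymmetric := by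
  obtain ⟨σ, hσ⟩ := exists_tendsto_simpleKernelCLM hX hμX k
  intro f g
  have hev : ∀ f, Tendsto (fun n => simpleKernelCLM μ k (σ n) f) atTop (𝓝 (kernelCLM μ k f)) :=
    fun f => ((ContinuousLinearMap.apply ℂ (Lp ℂ 2 μ) f).continuous.tendsto _).comp hσ
  have h1 := (hev f).inner (𝕜 := ℂ) (tendsto_const_nhds (x := g))
  have h2 := (tendsto_const_nhds (x := f)).inner (𝕜 := ℂ) (hev g)
  simp only [inner_simpleKernelCLM hk] at h1
  exact tendsto_nhds_unique h1 h2

/-- If the kernel is nearly invariant under the flow, its operator nearly commutes with the Koopman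
operators. -/
theorem norm_kernelCLM_koopman_sub_le {Φ : Flow ℝ Ω} (hinv : IsInvariant Φ μ)
    (hμX : μ μ.supportᶜ = 0) (k : Ω × Ω →ᵇ ℝ) {t C : ℝ} (hC : 0 ≤ C)
    (h : ∀ x ∈ μ.support, ∀ y ∈ μ.support, |k (x, y) - k (Φ t x, Φ t y)| ≤ C) (f : Lp ℂ 2 μ) :
    ‖kernelCLM μ k (koopman Φ hinv t f) - koopman Φ hinv t (kernelCLM μ k f)‖ ≤ C * ‖f‖ := by
  refine norm_Lp_le_of_ae_bound (by positivity) ?_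
  filter_upwards [Lp.coeFn_sub (kernelCLM μ k (koopman Φ hinv t f))
      (koopman Φ hinv t (kernelCLM μ k f)), coeFn_kernelOp k (koopman Φ hinv t f),
    coeFn_koopman hinv t (kernelCLM μ k f),
    (hinv t).quasiMeasurePreserving.ae (coeFn_kernelOp k f), ae_mem_support hμX]
    with x h1 h2 h3 h4 hx
  have h2' : kernelCLM μ k (koopman Φ hinv t f) x = kernelIntegral μ k (koopman Φ hinv t f) x := h2
  have h4' : kernelCLM μ k f (Φ t x) = kernelIntegral μ k f (Φ t x) := h4
  have h5 : kernelIntegral μ k f (Φ t x)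
      = ∫ y, (k (Φ t x, Φ t y) : ℂ) * koopman Φ hinv t f y ∂μ := by
    rw [kernelIntegral, ← integral_comp_flow hinv t]
    refine integral_congr_ae ?_
    filter_upwards [coeFn_koopman hinv t f] with y hy
    rw [hy]
  have hf := integrable_of_Lp (koopman Φ hinv t f)
  have hi : Integrable (fun y => (k (Φ t x, Φ t y) : ℂ) * koopman Φ hinv t f y) μ := by
    refine (hf.norm.const_mul ‖k‖).mono' ?_ (Eventually.of_forall fun y => ?_)
    · refine AEStronglyMeasurable.mul ?_ hf.1
      have hc : Continuous fun y => (k (Φ t x, Φ t y) : ℂ) :=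
        Complex.continuous_ofReal.comp (k.continuous.comp
          (continuous_const.prodMk (Φ.continuous_toFun t)))
      exact hc.measurable.stronglyMeasurable.aestronglyMeasurable
    · rw [norm_mul, Complex.norm_real]
      exact mul_le_mul_of_nonneg_right (k.norm_coe_le_norm _) (norm_nonneg _)
  rw [h1, Pi.sub_apply, h2', h3, h4', h5, kernelIntegral,
    ← integral_sub (integrable_kernel_mul k hf x) hi]
  simp only [← sub_mul]
  rw [← (koopman Φ hinv t).norm_map f]
  refine norm_integral_mul_le ?_ hf
  filter_upwards [ae_mem_support hμX] with y hy
  rw [← Complex.ofReal_sub, Complex.norm_real]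
  exact h x hx y hy

end Kernel

section Deriv

variable {α : Type*} [MeasurableSpace α] {μ : Measure α}
  {B : Type*} [NormedAddCommGroup B] [NormedSpace ℝ B]

theorem tendsto_slope_seq {g : ℝ → B} (hg : DifferentiableAt ℝ g 0) :
    Tendsto (fun n : ℕ => (1 / ((n : ℝ) + 1))⁻¹ • (g (1 / ((n : ℝ) + 1)) - g 0)) atTop
      (𝓝 (deriv g 0)) := by
  have h1 := hasDerivAt_iff_tendsto_slope_zero.1 hg.hasDerivAt
  have h2 : Tendsto (fun n : ℕ => 1 / ((n : ℝ) + 1)) atTop (𝓝[≠] 0) := by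
    refine tendsto_nhdsWithin_iff.2 ⟨tendsto_one_div_add_atTop_nhds_zero_nat, ?_⟩
    refine Eventually.of_forall fun n => ?_
    have : (0 : ℝ) < 1 / ((n : ℝ) + 1) := by positivity
    exact this.ne'
  refine (h1.comp h2).congr fun n => ?_
  simp

theorem aestronglyMeasurable_deriv_zero {f : ℝ → α → B}
    (hmeas : ∀ t, AEStronglyMeasurable (f t) μ)
    (hd : ∀ᵐ a ∂μ, DifferentiableAt ℝ (fun t => f t a) 0) :
    AEStronglyMeasurable (fun a => deriv (fun t => f t a) 0) μ := by
  refine aestronglyMeasurable_of_tendsto_ae atTop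
    (f := fun (n : ℕ) a => (1 / ((n : ℝ) + 1))⁻¹ • (f (1 / ((n : ℝ) + 1)) a - f 0 a))
    (fun n => ((hmeas _).sub (hmeas _)).const_smul _) ?_
  filter_upwards [hd] with a ha
  exact tendsto_slope_seq ha

theorem differentiableAt_integral_of_lipschitz {f : ℝ → α → B} {C : α → ℝ}
    (hmeas : ∀ t, AEStronglyMeasurable (f t) μ) (hint : Integrable (f 0) μ) (hC : Integrable C μ)
    (hL : ∀ᵐ a ∂μ, ∀ s t, ‖f s a - f t a‖ ≤ C a * |s - t|)
    (hd : ∀ᵐ a ∂μ, DifferentiableAt ℝ (fun t => f t a) 0) :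
    DifferentiableAt ℝ (fun t => ∫ a, f t a ∂μ) 0 := by
  refine (hasDerivAt_integral_of_dominated_loc_of_lip (F' := fun a => deriv (fun t => f t a) 0)
    (bound := C) univ_mem (Eventually.of_forall hmeas) hint
    (aestronglyMeasurable_deriv_zero hmeas hd) ?_ hC ?_).2.differentiableAt
  · filter_upwards [hL] with a ha
    refine LipschitzOnWith.of_dist_le_mul fun s _ t _ => ?_
    rw [dist_eq_norm, Real.dist_eq]
    refine (ha s t).trans ?_
    rw [Real.coe_nnabs]
    gcongr
    exact le_abs_self _
  · filter_upwards [hd] with a ha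
    exact ha.hasDerivAt

end Deriv

section SupNorm

variable {α : Type*} {s : Set α} {f : α → ℝ}

theorem supNormOn_nonneg (s : Set α) (f : α → ℝ) : 0 ≤ supNormOn s f :=
  Real.sSup_nonneg (by rintro _ ⟨x, -, rfl⟩; exact abs_nonneg _)

theorem abs_le_supNormOn {B : ℝ} (hB : ∀ x ∈ s, |f x| ≤ B) {x : α} (hx : x ∈ s) :
    |f x| ≤ supNormOn s f :=
  le_csSup ⟨B, by rintro _ ⟨y, hy, rfl⟩; exact hB y hy⟩ ⟨x, hx, rfl⟩

theorem supNormOn_le {B : ℝ} (hB0 : 0 ≤ B) (hB : ∀ x ∈ s, |f x| ≤ B) : supNormOn s f ≤ B :=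
  Real.sSup_le (by rintro _ ⟨y, hy, rfl⟩; exact hB y hy) hB0

theorem halfLineC1Norm_nonneg (h : ℝ → ℝ) : 0 ≤ halfLineC1Norm h :=
  add_nonneg (supNormOn_nonneg _ _) (supNormOn_nonneg _ _)

theorem IsShapeFunction.abs_sub_le {h : ℝ → ℝ} (hh : IsShapeFunction h) {u v : ℝ} (hu : 0 ≤ u)
    (hv : 0 ≤ v) : |h u - h v| ≤ halfLineC1Norm h * |u - v| := by
  obtain ⟨B, hB⟩ := hh.bounded_deriv
  have := (convex_Ici (0 : ℝ)).norm_image_sub_le_of_norm_derivWithin_le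
    (hh.contDiffOn.differentiableOn (by norm_num)) (C := halfLineC1Norm h) (fun x hx => ?_)
    (show v ∈ Ici (0 : ℝ) from hv) (show u ∈ Ici (0 : ℝ) from hu)
  · simpa [Real.norm_eq_abs] using this
  · rw [Real.norm_eq_abs]
    refine (abs_le_supNormOn (fun y hy => hB y hy) hx).trans ?_
    exact le_add_of_nonneg_left (supNormOn_nonneg _ _)

end SupNorm

section Koopman

variable {Ω : Type*} [MetricSpace Ω] [MeasurableSpace Ω] [BorelSpace Ω]
  {Φ : Flow ℝ Ω} {μ : Measure Ω} [IsProbabilityMeasure μ]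

/-- A continuous function that is differentiable and Lipschitz along the flow belongs to the domain
of the generator. -/
theorem exists_hasDerivAt_koopman (hinv : IsInvariant Φ μ) {g : Ω → ℂ} (hg : Continuous g)
    (hg2 : MemLp g 2 μ) {C : ℝ} (hC : 0 ≤ C)
    (hd : ∀ᵐ x ∂μ, DifferentiableAt ℝ (fun t => g (Φ t x)) 0)
    (hL : ∀ᵐ x ∂μ, ∀ t, ‖g (Φ t x) - g x‖ ≤ C * |t|) :
    ∃ G' : Lp ℂ 2 μ, HasDerivAt (fun t => koopman Φ hinv t (hg2.toLp g)) G' 0 ∧ ‖G'‖ ≤ C := by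
  let g' : Ω → ℂ := fun x => deriv (fun t => g (Φ t x)) 0
  have hmeas : ∀ t, AEStronglyMeasurable (fun x => g (Φ t x)) μ := fun t =>
    (hg.comp (Φ.continuous_toFun t)).measurable.stronglyMeasurable.aestronglyMeasurable
  have hg'm : AEStronglyMeasurable g' μ := aestronglyMeasurable_deriv_zero hmeas hd
  have hg'C : ∀ᵐ x ∂μ, ‖g' x‖ ≤ C := by
    filter_upwards [hd, hL] with x hx hx'
    refine hx.hasDerivAt.le_of_lip' hC (Eventually.of_forall fun t => ?_)
    simpa [Φ.map_zero_apply] using hx' t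
  have hg'2 : MemLp g' 2 μ := MemLp.of_bound hg'm C hg'C
  refine ⟨hg'2.toLp g', ?_, ?_⟩
  · rw [hasDerivAt_iff_tendsto_slope_zero, tendsto_iff_norm_sub_tendsto_zero]
    have hsq : Tendsto (fun t : ℝ => ‖t⁻¹ • (koopman Φ hinv (0 + t) (hg2.toLp g) -
        koopman Φ hinv 0 (hg2.toLp g)) - hg'2.toLp g'‖ ^ 2) (𝓝[≠] 0) (𝓝 0) := by
      have heq : ∀ t : ℝ, ‖t⁻¹ • (koopman Φ hinv (0 + t) (hg2.toLp g) -
          koopman Φ hinv 0 (hg2.toLp g)) - hg'2.toLp g'‖ ^ 2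
          = ∫ x, ‖t⁻¹ • (g (Φ t x) - g x) - g' x‖ ^ 2 ∂μ := by
        intro t
        rw [norm_Lp_sq_eq_integral, zero_add, koopman_zero, koopman_toLp]
        refine integral_congr_ae ?_
        filter_upwards [Lp.coeFn_sub (t⁻¹ • ((hg2.comp_measurePreserving (hinv t)).toLp _ -
            hg2.toLp g)) (hg'2.toLp g'), Lp.coeFn_smul t⁻¹
            ((hg2.comp_measurePreserving (hinv t)).toLp _ - hg2.toLp g),
            Lp.coeFn_sub ((hg2.comp_measurePreserving (hinv t)).toLp _) (hg2.toLp g),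
            hg2.coeFn_toLp, hg'2.coeFn_toLp,
            (hg2.comp_measurePreserving (hinv t)).coeFn_toLp] with x h1 h2 h3 h4 h5 h6
        rw [h1, Pi.sub_apply, h2, Pi.smul_apply, h3, Pi.sub_apply, h4, h5, h6]
        rfl
      simp only [heq]
      rw [show 𝓝 (0 : ℝ) = 𝓝 (∫ _x, (0 : ℝ) ∂μ) by simp]
      refine tendsto_integral_filter_of_dominated_convergence (fun _ => (C + C) ^ 2) ?_ ?_
        (integrable_const _) ?_
      · refine Eventually.of_forall fun t => ?_
        have hm0 : AEStronglyMeasurable g μ := hg2.1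
        exact ((((hmeas t).sub hm0).const_smul t⁻¹).sub hg'm).norm.pow 2
      · refine eventually_nhdsWithin_of_forall fun t (ht : t ≠ 0) => ?_
        filter_upwards [hL, hg'C] with x h1 h2
        rw [Real.norm_of_nonneg (by positivity)]
        have h3 : ‖t⁻¹ • (g (Φ t x) - g x)‖ ≤ C := by
          rw [norm_smul, norm_inv, Real.norm_eq_abs, inv_mul_le_iff₀ (abs_pos.2 ht), mul_comm]
          exact h1 t
        gcongr
        exact (norm_sub_le _ _).trans (add_le_add h3 h2)
      · filter_upwards [hd] with x hx
        have h1 := hasDerivAt_iff_tendsto_slope_zero.1 hx.hasDerivAt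
        have h2 := ((h1.sub_const (g' x)).norm).pow 2
        simpa [g', Φ.map_zero_apply] using h2
    have := hsq.sqrt
    simpa [Real.sqrt_sq (norm_nonneg _)] using this
  · refine norm_Lp_le_of_ae_bound hC ?_
    filter_upwards [hg'2.coeFn_toLp, hg'C] with x h1 h2
    rwa [h1]

/-- If a kernel is differentiable and Lipschitz along the flow in its first variable, its integral
operator maps into the domain of the generator. -/
theorem exists_hasDerivAt_koopman_kernelCLM (hinv : IsInvariant Φ μ) (hμX : μ μ.supportᶜ = 0)
    (k : Ω × Ω →ᵇ ℝ) {C : ℝ} (hC : 0 ≤ C)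
    (hd : ∀ x ∈ μ.support, ∀ y ∈ μ.support, DifferentiableAt ℝ (fun t => k (Φ t x, y)) 0)
    (hL : ∀ x ∈ μ.support, ∀ y ∈ μ.support, ∀ s t : ℝ,
      |k (Φ s x, y) - k (Φ t x, y)| ≤ C * |s - t|) (f : Lp ℂ 2 μ) :
    ∃ G' : Lp ℂ 2 μ, HasDerivAt (fun t => koopman Φ hinv t (kernelCLM μ k f)) G' 0 ∧
      ‖G'‖ ≤ C * ‖f‖ := by
  have hf := integrable_of_Lp f
  refine exists_hasDerivAt_koopman hinv (continuous_kernelIntegral k hf)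
    (memLp_kernelIntegral k hf) (by positivity) ?_ ?_
  · filter_upwards [ae_mem_support hμX] with x hx
    refine differentiableAt_integral_of_lipschitz (f := fun t y => (k (Φ t x, y) : ℂ) * f y)
      (C := fun y => C * ‖f y‖) (fun t => aestronglyMeasurable_kernel_mul k hf.1 _)
      (integrable_kernel_mul k hf _) (hf.norm.const_mul C) ?_ ?_
    · filter_upwards [ae_mem_support hμX] with y hy s t
      rw [← sub_mul, norm_mul, ← Complex.ofReal_sub, Complex.norm_real, Real.norm_eq_abs]
      calc _ ≤ C * |s - t| * ‖f y‖ := by gcongr; exact hL x hx y hy s t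
        _ = _ := by ring
    · filter_upwards [ae_mem_support hμX] with y hy
      exact ((hd x hx y hy).hasDerivAt.ofReal_comp.mul_const (f y)).differentiableAt
  · filter_upwards [ae_mem_support hμX] with x hx t
    rw [kernelIntegral, kernelIntegral, ← integral_sub (integrable_kernel_mul k hf _)
      (integrable_kernel_mul k hf _)]
    simp only [← sub_mul]
    refine (norm_integral_mul_le (C := C * |t|) ?_ hf).trans_eq (by ring)
    filter_upwards [ae_mem_support hμX] with y hy
    have := hL x hx y hy t 0
    rw [Φ.map_zero_apply, sub_zero] at this
    rwa [← Complex.ofReal_sub, Complex.norm_real]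

end Koopman

section Delay

variable {Ω : Type*} [MetricSpace Ω] {Y : Type*} [NormedAddCommGroup Y]
  {Φ : Flow ℝ Ω} {F : Ω → Y} {T : ℝ}

theorem dSq_nonneg (F : Ω → Y) (p : Ω × Ω) : 0 ≤ dSq F p := by
  unfold dSq; positivity

theorem dSq_swap (F : Ω → Y) (x y : Ω) : dSq F (x, y) = dSq F (y, x) := by
  simp only [dSq, norm_sub_rev]

theorem continuous_dSq (hF : Continuous F) : Continuous (dSq F) := by
  unfold dSq; fun_prop

theorem delayDSq_swap (x y : Ω) : delayDSq Φ F T (x, y) = delayDSq Φ F T (y, x) := by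
  simp only [delayDSq, dSq_swap F (Φ _ x)]

theorem continuous_dSq_flow (hF : Continuous F) (x y : Ω) :
    Continuous fun t => dSq F (Φ t x, Φ t y) := by
  refine (continuous_dSq hF).comp ?_
  exact (Φ.continuous continuous_id continuous_const).prodMk
    (Φ.continuous continuous_id continuous_const)

/-- The delay distance changes slowly along the flow. -/
theorem abs_delayDSq_sub_le (hF : Continuous F) (hT : 0 < T) {X : Set Ω} {D : ℝ}
    (hX : ∀ t, ∀ x ∈ X, Φ t x ∈ X) (hD : ∀ x ∈ X, ∀ y ∈ X, dSq F (x, y) ≤ D) {x y : Ω}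
    (hx : x ∈ X) (hy : y ∈ X) (t : ℝ) :
    |delayDSq Φ F T (x, y) - delayDSq Φ F T (Φ t x, Φ t y)| ≤ D * |t| / T := by
  have key : ∀ x ∈ X, ∀ y ∈ X, ∀ t, 0 ≤ t →
      |delayDSq Φ F T (x, y) - delayDSq Φ F T (Φ t x, Φ t y)| ≤ D * t / T := by
    intro x hx y hy t ht
    have hi : ∀ a b, IntervalIntegrable (fun s => dSq F (Φ s x, Φ s y)) volume a b :=
      fun a b => (continuous_dSq_flow hF x y).intervalIntegrable a b
    have h1 : delayDSq Φ F T (Φ t x, Φ t y)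
        = (1 / T) * ∫ s in (0 + t)..(T + t), dSq F (Φ s x, Φ s y) := by
      rw [delayDSq, ← intervalIntegral.integral_comp_add_right
        (fun s => dSq F (Φ s x, Φ s y))]
      simp only [Φ.map_add]
    have hb : ∀ a b : ℝ, a ≤ b → 0 ≤ ∫ s in a..b, dSq F (Φ s x, Φ s y) ∧
        ∫ s in a..b, dSq F (Φ s x, Φ s y) ≤ D * (b - a) := by
      intro a b hab
      refine ⟨intervalIntegral.integral_nonneg hab fun s _ => dSq_nonneg _ _, ?_⟩
      have := intervalIntegral.integral_mono_on hab (hi a b)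
        (intervalIntegrable_const (c := D)) fun s _ => hD _ (hX s x hx) _ (hX s y hy)
      rw [intervalIntegral.integral_const, smul_eq_mul] at this
      linarith
    have h2 := intervalIntegral.integral_add_adjacent_intervals (hi 0 t) (hi t (T + t))
    have h3 := intervalIntegral.integral_add_adjacent_intervals (hi 0 T) (hi T (T + t))
    obtain ⟨h4, h5⟩ := hb 0 t ht
    obtain ⟨h6, h7⟩ := hb T (T + t) (by linarith)
    rw [h1, zero_add, delayDSq, ← mul_sub, abs_mul, abs_of_pos (by positivity : 0 < 1 / T),
      one_div_mul_eq_div]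
    gcongr
    rw [abs_le]
    constructor <;> simp only at * <;> linarith
  rcases le_total 0 t with ht | ht
  · rw [abs_of_nonneg ht]
    exact key x hx y hy t ht
  · have := key _ (hX t x hx) _ (hX t y hy) (-t) (by linarith)
    rw [← Φ.map_add, ← Φ.map_add, neg_add_cancel, Φ.map_zero_apply, Φ.map_zero_apply,
      abs_sub_comm] at this
    rwa [abs_of_nonpos ht]

variable {X : Set Ω} {D : ℝ}

/-- The delay distance inherits Lipschitz bounds along the flow in the first variable. -/
theorem abs_delayDSq_flow_sub_le (hF : Continuous F) (hT : 0 < T)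
    (hX : ∀ t, ∀ x ∈ X, Φ t x ∈ X)
    (hL : ∀ x ∈ X, ∀ y ∈ X, ∀ s t : ℝ,
      |dSq F (Φ s x, y) - dSq F (Φ t x, y)| ≤ D * |s - t|) {x y : Ω}
    (hx : x ∈ X) (hy : y ∈ X) (s t : ℝ) :
    |delayDSq Φ F T (Φ s x, y) - delayDSq Φ F T (Φ t x, y)| ≤ D * |s - t| := by
  have hi : ∀ s, IntervalIntegrable (fun u => dSq F (Φ u (Φ s x), Φ u y)) volume 0 T :=
    fun s => (continuous_dSq_flow hF _ _).intervalIntegrable _ _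
  have h1 : ‖∫ u in (0 : ℝ)..T, (dSq F (Φ u (Φ s x), Φ u y) - dSq F (Φ u (Φ t x), Φ u y))‖
      ≤ D * |s - t| * |T - 0| := by
    refine intervalIntegral.norm_integral_le_of_norm_le_const fun u _ => ?_
    rw [← Φ.map_add, ← Φ.map_add, add_comm u s, add_comm u t, Φ.map_add, Φ.map_add]
    exact hL _ (hX u x hx) _ (hX u y hy) s t
  rw [intervalIntegral.integral_sub (hi s) (hi t), sub_zero, abs_of_pos hT,
    Real.norm_eq_abs] at h1
  simp only [delayDSq]
  rw [← mul_sub, abs_mul, abs_of_pos (by positivity : 0 < 1 / T), one_div_mul_eq_div,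
    div_le_iff₀ hT]
  exact h1

theorem differentiableAt_delayDSq_flow (hF : Continuous F) (hT : 0 < T)
    (hX : ∀ t, ∀ x ∈ X, Φ t x ∈ X)
    (hL : ∀ x ∈ X, ∀ y ∈ X, ∀ s t : ℝ,
      |dSq F (Φ s x, y) - dSq F (Φ t x, y)| ≤ D * |s - t|)
    (hd : ∀ x ∈ X, ∀ y ∈ X, DifferentiableAt ℝ (fun t => dSq F (Φ t x, y)) 0) {x y : Ω}
    (hx : x ∈ X) (hy : y ∈ X) :
    DifferentiableAt ℝ (fun t => delayDSq Φ F T (Φ t x, y)) 0 := by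
  simp only [delayDSq, intervalIntegral.integral_of_le hT.le]
  refine DifferentiableAt.const_mul ?_ _
  have hcomm : ∀ u t : ℝ, Φ u (Φ t x) = Φ t (Φ u x) := fun u t => by
    rw [← Φ.map_add, add_comm, Φ.map_add]
  refine differentiableAt_integral_of_lipschitz (C := fun _ => D)
    (fun t => (continuous_dSq_flow hF _ _).aestronglyMeasurable)
    ((continuous_dSq_flow hF _ _).integrableOn_Ioc) (integrable_const _) ?_ ?_
  · refine Eventually.of_forall fun u s t => ?_
    rw [hcomm u s, hcomm u t]
    exact hL _ (hX u x hx) _ (hX u y hy) s t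
  · refine Eventually.of_forall fun u => ?_
    have : (fun t => dSq F (Φ u (Φ t x), Φ u y)) = fun t => dSq F (Φ t (Φ u x), Φ u y) := by
      funext t
      rw [hcomm u t]
    rw [this]
    exact hd _ (hX u x hx) _ (hX u y hy)

variable {h : ℝ → ℝ} {hh : IsShapeFunction h} {hF : Continuous F} {hT : 0 < T}

theorem delayKernel_apply (p : Ω × Ω) : delayKernel Φ hF hh hT p = h (delayDSq Φ F T p) := rfl

theorem delayKernel_swap (x y : Ω) :
    delayKernel Φ hF hh hT (x, y) = delayKernel Φ hF hh hT (y, x) := by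
  rw [delayKernel_apply, delayKernel_apply, delayDSq_swap]

theorem abs_delayKernel_sub_le (p q : Ω × Ω) :
    |delayKernel Φ hF hh hT p - delayKernel Φ hF hh hT q|
      ≤ halfLineC1Norm h * |delayDSq Φ F T p - delayDSq Φ F T q| :=
  hh.abs_sub_le (delayDSq_nonneg Φ F hT p) (delayDSq_nonneg Φ F hT q)

theorem differentiableAt_delayKernel_flow {x y : Ω}
    (hd : DifferentiableAt ℝ (fun t => delayDSq Φ F T (Φ t x, y)) 0) :
    DifferentiableAt ℝ (fun t => delayKernel Φ hF hh hT (Φ t x, y)) 0 := by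
  simp only [delayKernel_apply]
  rw [← differentiableWithinAt_univ] at hd ⊢
  exact DifferentiableWithinAt.comp (g := h) (f := fun t => delayDSq Φ F T (Φ t x, y)) 0
    (hh.contDiffOn.differentiableOn (by norm_num) _ (delayDSq_nonneg Φ F hT _)) hd
    fun t _ => delayDSq_nonneg Φ F hT _

end Delay

section Manifold

variable {E : Type*} [NormedAddCommGroup E] [NormedSpace ℝ E]
  {H : Type*} [TopologicalSpace H] {I : ModelWithCorners ℝ E H}
  {M : Type*} [TopologicalSpace M] [ChartedSpace H M] [IsManifold I 1 M]
  [RiemannianBundle (fun x : M => TangentSpace I x)]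
  [IsContinuousRiemannianBundle E (fun x : M => TangentSpace I x)]

theorem eventually_norm_trivialization_apply_le (x₀ : M) :
    ∃ C > 0, ∀ᶠ x in 𝓝 x₀, ∀ w : TangentSpace I x,
      ‖(trivializationAt E (TangentSpace I) x₀).continuousLinearMapAt ℝ x w‖ ≤ C * ‖w‖ := by
  obtain ⟨C, hC, h⟩ := eventually_norm_trivializationAt_lt E (fun x : M => TangentSpace I x) x₀
  refine ⟨C, hC, ?_⟩
  filter_upwards [h] with x hx w
  have := ContinuousLinearMap.le_opNorm
    (((trivializationAt E (fun x : M => TangentSpace I x) x₀).continuousLinearMapAt ℝ x)) w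
  exact this.trans (by gcongr)

theorem eventually_abs_mfderiv_fst_le {f : M × M → ℝ} (hf : ContMDiff (I.prod I) 𝓘(ℝ, ℝ) 1 f)
    (p₀ : M × M) :
    ∃ B : ℝ, ∀ᶠ p in 𝓝 p₀, ∀ w : TangentSpace I p.1,
      |(show ℝ from mfderiv I 𝓘(ℝ, ℝ) (fun x => f (x, p.2)) p.1 w)| ≤ B * ‖w‖ := by
  have hf' : ContMDiffAt ((I.prod I).prod I) 𝓘(ℝ, ℝ) 1
      (Function.uncurry fun (p : M × M) (x : M) => f (x, p.2)) (p₀, p₀.1) :=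
    (hf.comp (contMDiff_snd.prodMk (contMDiff_snd.comp contMDiff_fst))).contMDiffAt
  have h1 := (ContMDiffAt.mfderiv (m := 0) (n := 1) (x₀ := p₀)
    (fun (p : M × M) (x : M) => f (x, p.2)) (fun p => p.1) hf' contMDiffAt_fst
    (by norm_num)).continuousAt
  set A : M × M → E →L[ℝ] ℝ := inTangentCoordinates I 𝓘(ℝ, ℝ) (fun p : M × M => p.1)
    (fun p => f (p.1, p.2)) (fun p => mfderiv I 𝓘(ℝ, ℝ) (fun x => f (x, p.2)) p.1) p₀ with hA
  have h2 : ∀ᶠ p in 𝓝 p₀, ‖A p‖ < ‖A p₀‖ + 1 :=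
    h1.norm.eventually_lt continuousAt_const (lt_add_one _)
  obtain ⟨C, hC, h3⟩ := eventually_norm_trivialization_apply_le (I := I) p₀.1
  have h4 : ∀ᶠ p : M × M in 𝓝 p₀, p.1 ∈ (trivializationAt E (TangentSpace I) p₀.1).baseSet :=
    continuousAt_fst.eventually ((trivializationAt E (TangentSpace I) p₀.1).open_baseSet.mem_nhds
      (FiberBundle.mem_baseSet_trivializationAt' p₀.1))
  refine ⟨(‖A p₀‖ + 1) * C, ?_⟩
  filter_upwards [h2, continuousAt_fst.eventually h3, h4] with p h5 h6 h7 w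
  have h8 : A p ((trivializationAt E (TangentSpace I) p₀.1).continuousLinearMapAt ℝ p.1 w)
      = mfderiv I 𝓘(ℝ, ℝ) (fun x => f (x, p.2)) p.1 w := by
    have e1 : (trivializationAt E (TangentSpace I) p₀.1).symmL ℝ p.1
        ((trivializationAt E (TangentSpace I) p₀.1).continuousLinearMapAt ℝ p.1 w) = w :=
      Bundle.Trivialization.symmL_continuousLinearMapAt _ h7 w
    change (trivializationAt ℝ (TangentSpace 𝓘(ℝ, ℝ)) (f (p₀.1, p₀.2))).continuousLinearMapAt ℝ
      (f (p.1, p.2)) (mfderiv I 𝓘(ℝ, ℝ) (fun x => f (x, p.2)) p.1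
        ((trivializationAt E (TangentSpace I) p₀.1).symmL ℝ p.1
        ((trivializationAt E (TangentSpace I) p₀.1).continuousLinearMapAt ℝ p.1 w))) = _
    rw [e1, TangentBundle.continuousLinearMapAt_model_space]
    rfl
  have h9 := (A p).le_opNorm
    ((trivializationAt E (TangentSpace I) p₀.1).continuousLinearMapAt ℝ p.1 w)
  rw [h8] at h9
  calc _ ≤ _ := h9
    _ ≤ (‖A p₀‖ + 1) * (C * ‖w‖) := by gcongr; exact h6 w
    _ = _ := by ring

/-- The partial differentials of a `C¹` function on the square of a compact manifold are bounded. -/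
theorem exists_abs_mfderiv_fst_le [CompactSpace M] {f : M × M → ℝ}
    (hf : ContMDiff (I.prod I) 𝓘(ℝ, ℝ) 1 f) :
    ∃ B : ℝ, ∀ (p : M × M) (w : TangentSpace I p.1),
      |(show ℝ from mfderiv I 𝓘(ℝ, ℝ) (fun x => f (x, p.2)) p.1 w)| ≤ B * ‖w‖ := by
  choose B hB using fun p => eventually_abs_mfderiv_fst_le hf p
  obtain ⟨t, ht⟩ := CompactSpace.elim_nhds_subcover _ hB
  refine ⟨∑ q ∈ t, |B q|, fun p w => ?_⟩
  have hp := ht.ge (mem_univ p)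
  obtain ⟨q, hq, hpq⟩ := mem_iUnion₂.1 hp
  refine (hpq w).trans ?_
  gcongr
  exact (le_abs_self _).trans (Finset.single_le_sum (fun q _ => abs_nonneg (B q)) hq)

theorem dnorm_nonneg (f : M → ℝ) (x : M) : 0 ≤ dnorm I f x :=
  Real.sSup_nonneg (by rintro _ ⟨w, -, rfl⟩; exact abs_nonneg _)

theorem dnorm_le {f : M → ℝ} {x : M} {B : ℝ} (hB0 : 0 ≤ B)
    (hB : ∀ w : TangentSpace I x, |(show ℝ from mfderiv I 𝓘(ℝ, ℝ) f x w)| ≤ B * ‖w‖) :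
    dnorm I f x ≤ B := by
  refine Real.sSup_le ?_ hB0
  rintro _ ⟨w, hw, rfl⟩
  exact (hB w).trans (mul_le_of_le_one_right hB0 hw)

theorem abs_mfderiv_le_dnorm_mul {f : M → ℝ} {x : M} {B : ℝ} (hB0 : 0 ≤ B)
    (hB : ∀ w : TangentSpace I x, |(show ℝ from mfderiv I 𝓘(ℝ, ℝ) f x w)| ≤ B * ‖w‖)
    (w : TangentSpace I x) :
    |(show ℝ from mfderiv I 𝓘(ℝ, ℝ) f x w)| ≤ dnorm I f x * ‖w‖ := by
  by_cases hw : w = 0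
  · have := hB w
    simp only [hw, norm_zero, mul_zero] at this ⊢
    exact this
  have hn : 0 < ‖w‖ := norm_pos_iff.2 hw
  have h1 : |(show ℝ from mfderiv I 𝓘(ℝ, ℝ) f x (‖w‖⁻¹ • w))| ≤ dnorm I f x := by
    refine le_csSup ⟨B, ?_⟩ ⟨‖w‖⁻¹ • w, ?_, rfl⟩
    · rintro _ ⟨w, hw, rfl⟩
      exact (hB w).trans (mul_le_of_le_one_right hB0 hw)
    · rw [norm_smul, norm_inv, norm_norm, inv_mul_cancel₀ hn.ne']
  have h2 : (show ℝ from mfderiv I 𝓘(ℝ, ℝ) f x (‖w‖⁻¹ • w))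
      = ‖w‖⁻¹ * (show ℝ from mfderiv I 𝓘(ℝ, ℝ) f x w) := by
    rw [map_smul]; rfl
  rw [h2, abs_mul, abs_of_pos (inv_pos.2 hn), inv_mul_le_iff₀ hn] at h1
  rwa [mul_comm]

/-- A continuous vector field on a compact Riemannian manifold is bounded. -/
theorem exists_norm_vectorField_le [CompactSpace M] {v : (x : M) → TangentSpace I x}
    (hv : Continuous (fun x : M => (⟨x, v x⟩ : TangentBundle I M))) :
    ∃ B : ℝ, ∀ x, ‖v x‖ ≤ B := by
  have h1 : Continuous fun x => inner ℝ (v x) (v x) :=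
    Continuous.inner_bundle (F := E) (E := fun x : M => TangentSpace I x) hv hv
  obtain ⟨B, hB⟩ := isCompact_univ.bddAbove_image h1.norm.continuousOn
  refine ⟨Real.sqrt B, fun x => Real.le_sqrt_of_sq_le ?_⟩
  have := hB ⟨x, mem_univ x, rfl⟩
  rw [← real_inner_self_eq_norm_sq]
  exact (le_abs_self _).trans this

theorem vectorFieldNorm_nonneg (v : (x : M) → TangentSpace I x) : 0 ≤ vectorFieldNorm I v :=
  Real.sInf_nonneg fun _ hC => hC.1

theorem c1Norm_nonneg (f : M → ℝ) : 0 ≤ c1Norm I f :=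
  add_nonneg (supNormOn_nonneg _ _) (supNormOn_nonneg _ _)

theorem exists_abs_mfderiv_le [CompactSpace M] {f : M → ℝ} (hf : ContMDiff I 𝓘(ℝ, ℝ) 1 f) :
    ∃ B : ℝ, 0 ≤ B ∧ ∀ (x : M) (w : TangentSpace I x),
      |(show ℝ from mfderiv I 𝓘(ℝ, ℝ) f x w)| ≤ B * ‖w‖ := by
  obtain ⟨B, hB⟩ := exists_abs_mfderiv_fst_le (I := I) (hf.comp contMDiff_fst)
  refine ⟨|B|, abs_nonneg _, fun x w => (hB (x, x) w).trans ?_⟩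
  gcongr
  exact le_abs_self _

/-- The norm of a continuous vector field on a compact manifold bounds directional derivatives. -/
theorem abs_dirDeriv_le [CompactSpace M] {v : (x : M) → TangentSpace I x}
    (hv : Continuous (fun x : M => (⟨x, v x⟩ : TangentBundle I M))) {f : M → ℝ}
    (hf : ContMDiff I 𝓘(ℝ, ℝ) 1 f) (x : M) :
    |dirDeriv I v f x| ≤ vectorFieldNorm I v * c1Norm I f := by
  obtain ⟨A, hA⟩ := exists_norm_vectorField_le hv
  have hA0 : 0 ≤ A := (norm_nonneg _).trans (hA x)
  have hpt : ∀ f : M → ℝ, ContMDiff I 𝓘(ℝ, ℝ) 1 f → ∀ x, |dirDeriv I v f x| ≤ A * c1Norm I f := by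
    intro f hf x
    obtain ⟨B, hB0, hB⟩ := exists_abs_mfderiv_le hf
    have h1 : |dirDeriv I v f x| ≤ dnorm I f x * ‖v x‖ :=
      abs_mfderiv_le_dnorm_mul hB0 (hB x) (v x)
    have h2 : dnorm I f x ≤ c1Norm I f := by
      refine (le_abs_self _).trans ((abs_le_supNormOn (B := B) ?_ (mem_univ x)).trans
        (le_add_of_nonneg_left (supNormOn_nonneg _ _)))
      intro y _
      rw [abs_of_nonneg (dnorm_nonneg f y)]
      exact dnorm_le hB0 (hB y)
    calc _ ≤ _ := h1
      _ ≤ c1Norm I f * A := mul_le_mul h2 (hA x) (norm_nonneg _) (c1Norm_nonneg f)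
      _ = _ := mul_comm _ _
  set S := {C : ℝ | 0 ≤ C ∧ ∀ f : M → ℝ, ContMDiff I 𝓘(ℝ, ℝ) 1 f →
    supNormOn univ (dirDeriv I v f) ≤ C * c1Norm I f} with hS
  have hne : S.Nonempty := ⟨A, hA0, fun f hf =>
    supNormOn_le (mul_nonneg hA0 (c1Norm_nonneg f)) fun x _ => hpt f hf x⟩
  refine (abs_le_supNormOn (fun x _ => hpt f hf x) (mem_univ x)).trans ?_
  have hmul : ∀ C ∈ S, supNormOn univ (dirDeriv I v f) ≤ C * c1Norm I f := fun C hC => hC.2 f hf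
  rcases (c1Norm_nonneg (I := I) f).eq_or_lt with h0 | h0
  · obtain ⟨C, hC⟩ := hne
    have := hmul C hC
    rwa [← h0, mul_zero] at this ⊢
  · rw [← div_le_iff₀ h0]
    exact le_csInf hne fun C hC => (div_le_iff₀ h0).2 (hmul C hC)

/-- The `C¹` norm of a function of two variables dominates that of its sections. -/
theorem c1Norm_section_le [CompactSpace M] {f : M × M → ℝ}
    (hf : ContMDiff (I.prod I) 𝓘(ℝ, ℝ) 1 f) (y : M) :
    c1Norm I (fun x => f (x, y)) ≤ c1NormProd I f := by
  obtain ⟨B, hB⟩ := exists_abs_mfderiv_fst_le hf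
  obtain ⟨B', hB'⟩ := exists_abs_mfderiv_fst_le (hf.comp (contMDiff_snd.prodMk contMDiff_fst))
  have hB1 : ∀ p : M × M, dnorm I (fun x => f (x, p.2)) p.1 ≤ |B| := fun p =>
    dnorm_le (abs_nonneg _) fun w => (hB p w).trans (by gcongr; exact le_abs_self _)
  have hB2 : ∀ p : M × M, dnorm I (fun y => f (p.1, y)) p.2 ≤ |B'| := fun p =>
    dnorm_le (abs_nonneg _) fun w => (hB' (p.2, p.1) w).trans (by gcongr; exact le_abs_self _)
  obtain ⟨A, hA⟩ := isCompact_univ.bddAbove_image hf.continuous.norm.continuousOn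
  have hA' : ∀ p ∈ (univ : Set (M × M)), |f p| ≤ A := fun p hp => hA ⟨p, hp, rfl⟩
  have hdp : ∀ p ∈ (univ : Set (M × M)), |dnormProd I f p| ≤ Real.sqrt (|B| ^ 2 + |B'| ^ 2) := by
    intro p _
    rw [dnormProd, abs_of_nonneg (Real.sqrt_nonneg _)]
    have := dnorm_nonneg (I := I) (fun x => f (x, p.2)) p.1
    have := dnorm_nonneg (I := I) (fun y => f (p.1, y)) p.2
    have h1 := hB1 p
    have h2 := hB2 p
    gcongr
  refine add_le_add ?_ ?_
  · exact supNormOn_le (supNormOn_nonneg _ _) fun x _ => abs_le_supNormOn hA' (mem_univ (x, y))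
  · refine supNormOn_le (supNormOn_nonneg _ _) fun x _ => ?_
    refine le_trans ?_ (abs_le_supNormOn hdp (mem_univ (x, y)))
    rw [abs_of_nonneg (dnorm_nonneg _ _), dnormProd, abs_of_nonneg (Real.sqrt_nonneg _)]
    exact Real.le_sqrt_of_sq_le (le_add_of_nonneg_right (sq_nonneg _))

theorem c1NormProd_nonneg (f : M × M → ℝ) : 0 ≤ c1NormProd I f :=
  add_nonneg (supNormOn_nonneg _ _) (supNormOn_nonneg _ _)

theorem hasDerivWithinAt_comp_integralCurve {γ : ℝ → M} {v : (x : M) → TangentSpace I x}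
    {s : Set ℝ} (hγ : IsMIntegralCurveOn γ v s) {f : M → ℝ} (hf : ContMDiff I 𝓘(ℝ, ℝ) 1 f) {t : ℝ}
    (ht : t ∈ s) : HasDerivWithinAt (fun t => f (γ t)) (dirDeriv I v f (γ t)) s t := by
  have h1 := hγ t ht
  have h2 := ((hf.mdifferentiable (by norm_num)) (γ t)).hasMFDerivAt
  let L : ℝ →L[ℝ] ℝ :=
    (mfderiv I 𝓘(ℝ, ℝ) f (γ t)).comp ((1 : ℝ →L[ℝ] ℝ).smulRight (v (γ t)))
  have h3 : HasFDerivWithinAt (fun t => f (γ t)) L s t :=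
    (h2.comp_hasMFDerivWithinAt t h1).hasFDerivWithinAt
  refine h3.hasDerivWithinAt.congr_deriv ?_
  change mfderiv I 𝓘(ℝ, ℝ) f (γ t) ((1 : ℝ) • v (γ t)) = _
  rw [one_smul]
  rfl

end Manifold

section Orbits

variable {Ω : Type*} [MetricSpace Ω] [MeasurableSpace Ω] [BorelSpace Ω]
  {Φ : Flow ℝ Ω} {X : Set Ω}
  {E : Type*} [NormedAddCommGroup E] [NormedSpace ℝ E]
  {H : Type*} [TopologicalSpace H] {I : ModelWithCorners ℝ E H}
  {M : Set Ω} [ChartedSpace H M] [IsManifold I 1 M]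
  [RiemannianBundle (fun x : M => TangentSpace I x)]
  [IsContinuousRiemannianBundle E (fun x : M => TangentSpace I x)]
  {v : (x : M) → TangentSpace I x} {f : M × M → ℝ} {g : Ω × Ω → ℝ}

/-- Along orbits in an invariant subset of the manifold, `C¹` functions are differentiable for all
times, with derivative bounded by the norm of the generating vector field. -/
theorem exists_hasDerivAt_orbit [CompactSpace M] (hX : ∀ t, ∀ x ∈ X, Φ t x ∈ X) (hXM : X ⊆ M)
    (hM : ∀ t : ℝ, 0 ≤ t → MapsTo (Φ t) M M)
    (hv : Continuous (fun x : M => (⟨x, v x⟩ : TangentBundle I M)))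
    (hgen : ∀ x : M, IsMIntegralCurveOn (I := I) (forwardOrbit Φ M hM x) v (Ici 0))
    (hg : ContMDiff (I.prod I) 𝓘(ℝ, ℝ) 1 (fun p : M × M => g ((p.1 : Ω), (p.2 : Ω))))
    {x y : Ω} (hx : x ∈ X) (hy : y ∈ X) (t : ℝ) :
    ∃ d : ℝ, |d| ≤ vectorFieldNorm I v *
        c1NormProd I (fun p : M × M => g ((p.1 : Ω), (p.2 : Ω))) ∧
      HasDerivAt (fun t => g (Φ t x, y)) d t := by
  let y' : M := ⟨y, hXM hy⟩
  let x' : M := ⟨Φ (t - 1) x, hXM (hX _ x hx)⟩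
  have hs : ContMDiff I 𝓘(ℝ, ℝ) 1 (fun x : M => g ((x : Ω), (y' : Ω))) :=
    hg.comp (contMDiff_id.prodMk contMDiff_const)
  have h1 := (hasDerivWithinAt_comp_integralCurve (hgen x') hs (t := 1)
    (mem_Ici.2 zero_le_one)).hasDerivAt
    (Ici_mem_nhds one_pos)
  refine ⟨_, (abs_dirDeriv_le hv hs (forwardOrbit Φ M hM x' 1)).trans
    (mul_le_mul_of_nonneg_left (c1Norm_section_le hg y') (vectorFieldNorm_nonneg v)), ?_⟩
  have h2 : HasDerivAt (fun s => g ((forwardOrbit Φ M hM x' s : Ω), y))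
      (dirDeriv I v (fun x : M => g ((x : Ω), (y' : Ω))) (forwardOrbit Φ M hM x' 1))
      (t - (t - 1)) := by
    rw [sub_sub_cancel]; exact h1
  refine (h2.comp_sub_const t (t - 1)).congr_of_eventuallyEq ?_
  filter_upwards [lt_mem_nhds (sub_one_lt t)] with s hs'
  have : max (s - (t - 1)) 0 = s - (t - 1) := max_eq_left (by linarith)
  simp only [forwardOrbit, this, x']
  rw [← Φ.map_add, sub_add_cancel]

theorem lipschitz_of_hasDerivAt_bound {q : ℝ → ℝ} {D : ℝ}
    (hq : ∀ t, ∃ d, |d| ≤ D ∧ HasDerivAt q d t) (s t : ℝ) : |q s - q t| ≤ D * |s - t| := by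
  choose d hd hq using hq
  exact convex_univ.norm_image_sub_le_of_norm_hasDerivWithin_le
    (fun u _ => (hq u).hasDerivWithinAt) (fun u _ => hd u) (mem_univ t) (mem_univ s)

end Orbits

section Dimension

variable {G : Type*} [NormedAddCommGroup G] [InnerProductSpace ℂ G]

/-- In a space of dimension two there is no orthogonal system of three nonzero vectors. -/
theorem eq_zero_of_finrank_eq_two {W : Submodule ℂ G} (hW : Module.finrank ℂ W = 2) {a b c : G}
    (ha : a ∈ W) (hb : b ∈ W) (hc : c ∈ W) (ha0 : a ≠ 0) (hb0 : b ≠ 0) (hab : inner ℂ a b = 0)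
    (hac : inner ℂ a c = 0) (hbc : inner ℂ b c = 0) : c = 0 := by
  by_contra hc0
  have : FiniteDimensional ℂ W := Module.finite_of_finrank_pos (by omega)
  let e : Fin 3 → W := ![⟨a, ha⟩, ⟨b, hb⟩, ⟨c, hc⟩]
  have hli : LinearIndependent ℂ e := by
    refine linearIndependent_of_ne_zero_of_inner_eq_zero (fun i => ?_) fun i j hij => ?_
    · fin_cases i <;> simpa [e]
    · have hba := inner_eq_zero_symm.1 hab
      have hca := inner_eq_zero_symm.1 hac
      have hcb := inner_eq_zero_symm.1 hbc
      fin_cases i <;> fin_cases j <;> first | exact absurd rfl hij | assumption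
  have := hli.fintype_card_le_finrank
  rw [hW] at this
  simp at this

/-- An eigenvector for a simple eigenvalue is orthogonal to no other eigenvector. -/
theorem eq_zero_of_finrank_eq_one {W : Submodule ℂ G} (hW : Module.finrank ℂ W = 1) {a c : G}
    (ha : a ∈ W) (hc : c ∈ W) (ha0 : a ≠ 0) (hac : inner ℂ a c = 0) : c = 0 := by
  have ha0' : (⟨a, ha⟩ : W) ≠ 0 := fun h => ha0 (congrArg Subtype.val h)
  obtain ⟨d, hd⟩ := (finrank_eq_one_iff_of_nonzero' _ ha0').1 hW ⟨c, hc⟩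
  have hd' : d • a = c := congrArg Subtype.val hd
  rw [← hd', inner_smul_right, mul_eq_zero, inner_self_eq_zero] at hac
  rw [← hd', hac.resolve_right ha0, zero_smul]

variable {Ω : Type*} [MetricSpace Ω] [MeasurableSpace Ω] [BorelSpace Ω]
  {Φ : Flow ℝ Ω} {μ : Measure Ω} [IsProbabilityMeasure μ]

/-- A measure whose support is infinite has an infinite-dimensional `L²` space. -/
theorem finite_support_of_finiteDimensional [FiniteDimensional ℂ (Lp ℂ 2 μ)] :
    μ.support.Finite := by
  by_contra hinf
  obtain ⟨s, hsX, hcard⟩ := Set.Infinite.exists_subset_card_eq hinf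
    (Module.finrank ℂ (Lp ℂ 2 μ) + 1)
  obtain ⟨U, hU, hdisj⟩ := s.finite_toSet.t2_separation
  let e : s → Lp ℂ 2 μ := fun x =>
    indicatorConstLp 2 (hU x).2.measurableSet (measure_ne_top μ _) (1 : ℂ)
  have hin : ∀ x y : s, (inner ℂ (e x) (e y) : ℂ) = (μ.real (U x ∩ U y) : ℂ) := by
    intro x y
    simp only [e]
    rw [L2.inner_indicatorConstLp_indicatorConstLp (hU x).2.measurableSet (hU y).2.measurableSet]
    simp
  have hli : LinearIndependent ℂ e := by
    refine linearIndependent_of_ne_zero_of_inner_eq_zero (fun x h0 => ?_) fun x y hxy => ?_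
    · have h1 := hin x x
      rw [h0, inner_zero_left, inter_self] at h1
      have h2 : μ.real (U x) = 0 := by exact_mod_cast h1.symm
      have h3 := (Measure.mem_support_iff_forall _).1 (hsX x.2) (U x)
        ((hU x).2.mem_nhds (hU x).1)
      rw [measureReal_eq_zero_iff] at h2
      exact h3.ne' h2
    · change (inner ℂ (e x) (e y) : ℂ) = 0
      rw [hin, (hdisj x.2 y.2 fun h => hxy (Subtype.ext h)).inter_eq]
      simp
  have := hli.fintype_card_le_finrank
  rw [Fintype.card_coe, hcard] at this
  omega

/-- A finite invariant set consists of fixed points. -/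
theorem flow_eq_self_of_finite {X : Set Ω} (hXf : X.Finite) (hX : ∀ t, ∀ x ∈ X, Φ t x ∈ X) {x : Ω}
    (hx : x ∈ X) (t : ℝ) : Φ t x = x := by
  have hc : Continuous fun t => Φ t x := Φ.continuous continuous_id continuous_const
  have hp := isPreconnected_univ.image _ hc.continuousOn
  have hs := hXf.countable.isTotallyDisconnected _ (by rintro _ ⟨t, -, rfl⟩; exact hX t x hx) hp
  have := hs ⟨t, mem_univ t, rfl⟩ ⟨0, mem_univ 0, rfl⟩
  simpa [Φ.map_zero_apply] using this

/-- If an ergodic measure has finite support, it is a point mass. -/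
theorem exists_ae_eq_of_finite_support (hinv : IsInvariant Φ μ) (herg : IsErgodic Φ μ)
    (hμX : μ μ.supportᶜ = 0) (hfin : μ.support.Finite) : ∃ x, ∀ᵐ y ∂μ, y = x := by
  have hX : ∀ t, ∀ x ∈ μ.support, Φ t x ∈ μ.support := fun t x hx => map_mem_support hinv t hx
  obtain ⟨x, hx, hx0⟩ : ∃ x ∈ μ.support, μ {x} ≠ 0 := by
    by_contra! hcon
    have h1 : μ μ.support = 0 := by
      rw [← biUnion_of_singleton μ.support]
      exact (measure_biUnion_null_iff hfin.countable).2 hcon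
    obtain ⟨y, hy, hy'⟩ := ((ae_mem_support hμX).and (measure_eq_zero_iff_ae_notMem.1 h1)).exists
    exact hy' hy
  refine ⟨x, ?_⟩
  have hfix := flow_eq_self_of_finite hfin hX hx
  have h1 := (herg {x} (measurableSet_singleton x) fun t => ?_).resolve_left hx0
  · rw [ae_iff]
    exact (prob_compl_eq_zero_iff (measurableSet_singleton x)).2 h1
  · ext y
    simp only [mem_preimage, mem_singleton_iff]
    constructor
    · intro h
      rw [← hfix (-t), ← h, ← Φ.map_add, neg_add_cancel, Φ.map_zero_apply]
    · rintro rfl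
      exact hfix t

/-- The `L²` space of an ergodic flow is not two-dimensional. -/
theorem orthogonal_span_pair_ne_bot (hinv : IsInvariant Φ μ) (herg : IsErgodic Φ μ)
    (hμX : μ μ.supportᶜ = 0) {φ ψ : Lp ℂ 2 μ} (hφ1 : ‖φ‖ = 1) (hψ1 : ‖ψ‖ = 1)
    (hφψ : inner ℂ φ ψ = 0) : (Submodule.span ℂ {φ, ψ})ᗮ ≠ ⊥ := by
  intro hbot
  have : FiniteDimensional ℂ (Submodule.span ℂ {φ, ψ}) :=
    FiniteDimensional.span_of_finite ℂ (toFinite _)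
  rw [Submodule.orthogonal_eq_bot_iff] at hbot
  have : FiniteDimensional ℂ (Lp ℂ 2 μ) :=
    Module.finite_def.2 (hbot ▸ Submodule.fg_span (toFinite _))
  obtain ⟨x, hx⟩ :=
    exists_ae_eq_of_finite_support hinv herg hμX (finite_support_of_finiteDimensional (μ := μ))
  have hn : ∀ f : Lp ℂ 2 μ, ‖f‖ ^ 2 = ‖f x‖ ^ 2 := by
    intro f
    rw [norm_Lp_sq_eq_integral]
    have : (fun y => ‖f y‖ ^ 2) =ᵐ[μ] fun _ => ‖f x‖ ^ 2 := by
      filter_upwards [hx] with y hy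
      rw [hy]
    rw [integral_congr_ae this]
    simp
  have hi : (inner ℂ φ ψ : ℂ) = inner ℂ (φ x) (ψ x) := by
    rw [L2.inner_def]
    have : (fun y => (inner ℂ (φ y) (ψ y) : ℂ)) =ᵐ[μ] fun _ => inner ℂ (φ x) (ψ x) := by
      filter_upwards [hx] with y hy
      rw [hy]
    rw [integral_congr_ae this]
    simp
  have h1 := hn φ
  have h2 := hn ψ
  rw [hφ1] at h1
  rw [hψ1] at h2
  rw [hφψ] at hi
  have h3 : ‖(inner ℂ (φ x) (ψ x) : ℂ)‖ = ‖φ x‖ * ‖ψ x‖ := by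
    simp [mul_comm]
  rw [← hi, norm_zero, eq_comm, mul_eq_zero] at h3
  rcases h3 with h | h
  · rw [h] at h1; norm_num at h1
  · rw [h] at h2; norm_num at h2

/-- Inner products of real functions along the flow are real. -/
theorem im_inner_koopman_eq_zero (hinv : IsInvariant Φ μ) {f g : Lp ℂ 2 μ}
    (hf : ∀ᵐ x ∂μ, (f x).im = 0) (hg : ∀ᵐ x ∂μ, (g x).im = 0) (t : ℝ) :
    (inner ℂ f (koopman Φ hinv t g) : ℂ).im = 0 := by
  have h : (inner ℂ f (koopman Φ hinv t g) : ℂ)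
      = ∫ x, (((f x).re * (g (Φ t x)).re : ℝ) : ℂ) ∂μ := by
    rw [L2.inner_def]
    refine integral_congr_ae ?_
    filter_upwards [hf, (hinv t).quasiMeasurePreserving.ae hg, coeFn_koopman hinv t g]
      with x h1 h2 h3
    rw [h3]
    apply Complex.ext <;> simp [h1, h2]
    ring
  rw [h, integral_complex_ofReal, Complex.ofReal_im]

end Dimension

section Eigenfunctions

variable {Ω : Type*} [MetricSpace Ω] [MeasurableSpace Ω] [BorelSpace Ω]
  {Φ : Flow ℝ Ω} {μ : Measure Ω} [IsProbabilityMeasure μ]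

theorem generator_apply_eq (hinv : IsInvariant Φ μ) {f f' : Lp ℂ 2 μ}
    (hf : HasDerivAt (fun t => koopman Φ hinv t f) f' 0) (hm : f ∈ (generator Φ hinv).domain) :
    generator Φ hinv ⟨f, hm⟩ = f' :=
  hf.deriv

/-- Eigenfunctions of an integral operator whose kernel is regular along the flow belong to the
domain of the generator. -/
theorem exists_hasDerivAt_koopman_eigenfunction (hinv : IsInvariant Φ μ)
    (hμX : μ μ.supportᶜ = 0) (k : Ω × Ω →ᵇ ℝ) {C : ℝ} (hC : 0 ≤ C)
    (hd : ∀ x ∈ μ.support, ∀ y ∈ μ.support, DifferentiableAt ℝ (fun t => k (Φ t x, y)) 0)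
    (hL : ∀ x ∈ μ.support, ∀ y ∈ μ.support, ∀ s t : ℝ,
      |k (Φ s x, y) - k (Φ t x, y)| ≤ C * |s - t|) {f : Lp ℂ 2 μ} {a : ℝ} (ha : 0 < a)
    (hf : kernelCLM μ k f = (a : ℂ) • f) :
    ∃ f', HasDerivAt (fun t => koopman Φ hinv t f) f' 0 ∧ ‖f'‖ ≤ C / a * ‖f‖ := by
  obtain ⟨g, hg, hgn⟩ := exists_hasDerivAt_koopman_kernelCLM hinv hμX k hC hd hL f
  have ha' : (a : ℂ) ≠ 0 := Complex.ofReal_ne_zero.2 ha.ne'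
  refine ⟨(a : ℂ)⁻¹ • g, ?_, ?_⟩
  · have := hg.const_smul (a : ℂ)⁻¹
    refine this.congr_of_eventuallyEq (Eventually.of_forall fun t => ?_)
    change _ = (a : ℂ)⁻¹ • koopman Φ hinv t (kernelCLM μ k f)
    rw [hf, map_smul, smul_smul, inv_mul_cancel₀ ha', one_smul]
  · rw [norm_smul, norm_inv, Complex.norm_real, Real.norm_of_nonneg ha.le, inv_mul_le_iff₀ ha]
    refine hgn.trans_eq ?_
    field_simp

end Eigenfunctions

end KoopmanDelay

open KoopmanDelay in
theorem corollary3
    -- the flow and its invariant ergodic probability measure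
    {Ω : Type*} [MetricSpace Ω] [MeasurableSpace Ω] [BorelSpace Ω]
    (Φ : Flow ℝ Ω) (μ : Measure Ω) [IsProbabilityMeasure μ]
    (hinv : IsInvariant Φ μ) (_herg : IsErgodic Φ μ)
    (_hX : IsCompact μ.support) (_hμX : μ μ.supportᶜ = 0)
    -- the compact forward-invariant manifold, with a continuous Riemannian metric
    {E : Type*} [NormedAddCommGroup E] [NormedSpace ℝ E] [FiniteDimensional ℝ E]
    {H : Type*} [TopologicalSpace H] (I : ModelWithCorners ℝ E H)
    (M : Set Ω) [ChartedSpace H M] [IsManifold I 1 M]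
    [RiemannianBundle (fun x : M => TangentSpace I x)]
    [IsContinuousRiemannianBundle E (fun x : M => TangentSpace I x)]
    (_hMc : IsCompact M) (_hXM : μ.support ⊆ M)
    (hM : ∀ t : ℝ, 0 ≤ t → MapsTo (Φ t) M M)
    (_hΦM : ∀ (t : ℝ) (ht : 0 ≤ t), ContMDiff I I 1 ((hM t ht).restrict (Φ t) M M))
    -- the continuous vector field on `M` that generates the flow
    (v : (x : M) → TangentSpace I x)
    (_hv : Continuous (fun x : M => (⟨x, v x⟩ : TangentBundle I M)))
    (_hgen : ∀ x : M, IsMIntegralCurveOn (I := I) (forwardOrbit Φ M hM x) v (Ici 0))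
    -- the observation map
    {Y : Type*} [NormedAddCommGroup Y] [NormedSpace ℝ Y] [CompleteSpace Y]
    (F : Ω → Y) (hF : Continuous F) (_hFM : ContMDiff I 𝓘(ℝ, Y) 1 (fun x : M => F x))
    (_hd : ContMDiff (I.prod I) 𝓘(ℝ, ℝ) 1 (fun p : M × M => dSq F ((p.1 : Ω), (p.2 : Ω))))
    -- the shape function, the delay window, the kernel and its integral operator
    (h : ℝ → ℝ) (hh : IsShapeFunction h) (T : ℝ) (hT : 0 < T)
    (k : BoundedContinuousFunction (Ω × Ω) ℝ) (_hk : k = delayKernel Φ hF hh hT)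
    (K : Module.End ℂ (Lp ℂ 2 μ)) (_hK : K = kernelOp μ k)
    -- the eigenvalues and the real orthonormal eigenfunctions
    (lam nu : ℝ) (_hlam : 0 < lam) (_hlamnu : lam ≤ nu)
    (φ ψ : Lp ℂ 2 μ)
    (_hφ : K φ = (lam : ℂ) • φ) (_hψ : K ψ = (nu : ℂ) • ψ)
    (_hφ1 : ‖φ‖ = 1) (_hψ1 : ‖ψ‖ = 1) (_hφψ : inner ℂ φ ψ = 0)
    (_hφr : ∀ᵐ x ∂μ, (φ x).im = 0) (_hψr : ∀ᵐ x ∂μ, (ψ x).im = 0)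
    (_hsimple : lam ≠ nu → Module.finrank ℂ (K.eigenspace (lam : ℂ)) = 1 ∧
      Module.finrank ℂ (K.eigenspace (nu : ℂ)) = 1)
    (_hdouble : lam = nu → Module.finrank ℂ (K.eigenspace (lam : ℂ)) = 2)
    -- the observable and the constants of the bound
    (z : Lp ℂ 2 μ) (_hz : z = ((1 / Real.sqrt 2 : ℝ) : ℂ) • (φ + Complex.I • ψ))
    (γ δ δ' C₁ C₂ : ℝ)
    (_hγ : γ = spectralGap K lam nu)
    (_hδ : δ = (1 / Real.sqrt 2) * (nu - lam)) (_hδ' : δ' = δ / nu)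
    (_hC₁ : C₁ = 2 * halfLineC1Norm h * supNormOn (μ.support ×ˢ μ.support) (dSq F))
    (_hC₂ : C₂ = 2 * halfLineC1Norm h *
      c1NormProd I (fun p : M × M => dSq F ((p.1 : Ω), (p.2 : Ω))))
    (s S ε : ℝ → ℝ)
    (_hs : ∀ t, s t = (1 / γ) * (C₁ * t / T + 3 * δ))
    (_hS : ∀ t, S t = C₂ * vectorFieldNorm I v * (1 + δ') / lam * ∫ u in (0 : ℝ)..t, s u)
    (_hε : ∀ t, ε t = s t + 3 * Real.sqrt (S t))
    -- the everywhere-defined representative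
    (ζ : Ω → ℂ)
    (_hζ : ∀ x, ζ x = ((1 / Real.sqrt 2 : ℝ) : ℂ) *
      ∫ y, (k (x, y) : ℂ) * (φ y / (lam : ℂ) + Complex.I * (ψ y / (nu : ℂ))) ∂μ) :
    -- the frequency is well defined, real, and given by the three equivalent formulas
    ∃ (_ : φ ∈ (generator Φ hinv).domain) (hψV : ψ ∈ (generator Φ hinv).domain)
      (hzV : z ∈ (generator Φ hinv).domain) (ω : ℝ),
      (ω : ℂ) = (1 / Complex.I) * inner ℂ z (generator Φ hinv ⟨z, hzV⟩) ∧
      (ω : ℂ) = inner ℂ φ (generator Φ hinv ⟨ψ, hψV⟩) ∧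
      HasDerivAt (fun t : ℝ => (inner ℂ z (koopman Φ hinv t z) : ℂ)) (Complex.I * ω) 0 ∧
      -- the gap is positive, so that the bounds are meaningful
      0 < γ ∧
      -- approximate point spectrum and approximate eigenfunction
      (∀ t : ℝ, 0 ≤ t →
        Complex.exp (Complex.I * ω * t) ∈ approxPointSpectrum (koopman Φ hinv t) (ε t) ∧
        IsApproxEigenpair (koopman Φ hinv t) (ε t) (Complex.exp (Complex.I * ω * t)) z) ∧
      -- the bound is uniform on bounded time intervals
      (∀ τ : ℝ, 0 ≤ τ → ∀ t ∈ Icc 0 τ,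
        IsApproxEigenpair (koopman Φ hinv t) (ε τ) (Complex.exp (Complex.I * ω * t)) z) ∧
      -- the continuous representative
      (∀ x, Integrable
        (fun y => (k (x, y) : ℂ) * (φ y / (lam : ℂ) + Complex.I * (ψ y / (nu : ℂ)))) μ) ∧
      Continuous ζ ∧ ζ =ᵐ[μ] z := by
  have hcM : CompactSpace M := isCompact_iff_compactSpace.1 _hMc
  have hX : ∀ t, ∀ x ∈ μ.support, Φ t x ∈ μ.support := fun t x hx => map_mem_support hinv t hx
  have hnu : 0 < nu := _hlam.trans_le _hlamnu
  -- the kernel along the flow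
  set A := halfLineC1Norm h with hA
  have hA0 : 0 ≤ A := halfLineC1Norm_nonneg h
  set D := supNormOn (μ.support ×ˢ μ.support) (dSq F) with hD
  have hD0 : 0 ≤ D := supNormOn_nonneg _ _
  set D' := vectorFieldNorm I v * c1NormProd I (fun p : M × M => dSq F ((p.1 : Ω), (p.2 : Ω)))
    with hD'
  have hD'0 : 0 ≤ D' := mul_nonneg (vectorFieldNorm_nonneg v) (c1NormProd_nonneg _)
  have hDle : ∀ x ∈ μ.support, ∀ y ∈ μ.support, dSq F (x, y) ≤ D := by
    obtain ⟨B, hB⟩ := (_hX.prod _hX).bddAbove_image (continuous_dSq hF).norm.continuousOn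
    exact fun x hx y hy => (le_abs_self _).trans
      (abs_le_supNormOn (fun p hp => hB ⟨p, hp, rfl⟩) (mk_mem_prod hx hy))
  have horb := fun (x : Ω) (hx : x ∈ μ.support) (y : Ω) (hy : y ∈ μ.support) =>
    exists_hasDerivAt_orbit hX _hXM hM _hv _hgen _hd hx hy
  have hdL : ∀ x ∈ μ.support, ∀ y ∈ μ.support, ∀ s t : ℝ,
      |dSq F (Φ s x, y) - dSq F (Φ t x, y)| ≤ D' * |s - t| := fun x hx y hy =>
    lipschitz_of_hasDerivAt_bound (horb x hx y hy)
  have hdd : ∀ x ∈ μ.support, ∀ y ∈ μ.support,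
      DifferentiableAt ℝ (fun t => dSq F (Φ t x, y)) 0 := fun x hx y hy => by
    obtain ⟨d, -, hd⟩ := horb x hx y hy 0
    exact hd.differentiableAt
  have hkd : ∀ x ∈ μ.support, ∀ y ∈ μ.support, DifferentiableAt ℝ (fun t => k (Φ t x, y)) 0 := by
    intro x hx y hy
    rw [_hk]
    exact differentiableAt_delayKernel_flow (differentiableAt_delayDSq_flow hF hT hX hdL hdd hx hy)
  have hkL : ∀ x ∈ μ.support, ∀ y ∈ μ.support, ∀ s t : ℝ,
      |k (Φ s x, y) - k (Φ t x, y)| ≤ A * D' * |s - t| := by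
    intro x hx y hy s t
    rw [_hk, mul_assoc]
    exact (abs_delayKernel_sub_le _ _).trans
      (mul_le_mul_of_nonneg_left (abs_delayDSq_flow_sub_le hF hT hX hdL hx hy s t) hA0)
  have hkC : ∀ t, ∀ x ∈ μ.support, ∀ y ∈ μ.support,
      |k (x, y) - k (Φ t x, Φ t y)| ≤ A * D / T * |t| := by
    intro t x hx y hy
    rw [_hk]
    refine (abs_delayKernel_sub_le _ _).trans ((mul_le_mul_of_nonneg_left
      (abs_delayDSq_sub_le hF hT hX hDle hx hy t) hA0).trans_eq ?_)
    ring
  have hksymm : ∀ x y, k (x, y) = k (y, x) := by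
    rw [_hk]; exact delayKernel_swap
  -- the integral operator
  have hKK : K = (kernelCLM μ k : Lp ℂ 2 μ →ₗ[ℂ] Lp ℂ 2 μ) := by rw [_hK]; rfl
  subst hKK
  have hKcomp := isCompactOperator_kernelCLM _hX _hμX k
  have hKsymm := isSymmetric_kernelCLM _hX _hμX hksymm
  have hφ : kernelCLM μ k φ = (lam : ℂ) • φ := _hφ
  have hψ : kernelCLM μ k ψ = (nu : ℂ) • ψ := _hψ
  have hcomm : ∀ t f, ‖kernelCLM μ k (koopman Φ hinv t f) - koopman Φ hinv t (kernelCLM μ k f)‖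
      ≤ A * D / T * |t| * ‖f‖ := fun t f =>
    norm_kernelCLM_koopman_sub_le hinv _hμX k (by positivity) (hkC t) f
  have hφ0 : φ ≠ 0 := fun h0 => by simp [h0] at _hφ1
  have hψ0 : ψ ≠ 0 := fun h0 => by simp [h0] at _hψ1
  have hE : ∀ r, inner ℂ φ r = 0 → inner ℂ ψ r = 0 →
      kernelCLM μ k r = (lam : ℂ) • r ∨ kernelCLM μ k r = (nu : ℂ) • r → r = 0 := by
    intro r h1 h2 hr
    by_cases heq : lam = nu
    · subst heq
      exact eq_zero_of_finrank_eq_two (_hdouble rfl) (Module.End.mem_eigenspace_iff.2 hφ)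
        (Module.End.mem_eigenspace_iff.2 hψ) (Module.End.mem_eigenspace_iff.2 (or_self_iff.1 hr))
        hφ0 hψ0 _hφψ h1 h2
    · obtain ⟨e1, e2⟩ := _hsimple heq
      rcases hr with hr | hr
      · exact eq_zero_of_finrank_eq_one e1 (Module.End.mem_eigenspace_iff.2 hφ)
          (Module.End.mem_eigenspace_iff.2 hr) hφ0 h1
      · exact eq_zero_of_finrank_eq_one e2 (Module.End.mem_eigenspace_iff.2 hψ)
          (Module.End.mem_eigenspace_iff.2 hr) hψ0 h2
  have hγ0 : 0 < γ := by
    rw [_hγ]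
    exact spectralGap_pos hKcomp hKsymm hφ hψ hE _hlam hnu
      (orthogonal_span_pair_ne_bot hinv _herg _hμX _hφ1 _hψ1 _hφψ)
  have hgap : ∀ r, inner ℂ φ r = 0 → inner ℂ ψ r = 0 →
      γ * ‖r‖ ≤ ‖kernelCLM μ k r - (lam : ℂ) • r‖ := fun r h1 h2 => by
    rw [_hγ]
    exact spectralGap_mul_norm_le hKcomp hKsymm hφ hψ hE h1 h2
  -- the generator on the eigenfunctions
  obtain ⟨φ', hφ', -⟩ := exists_hasDerivAt_koopman_eigenfunction hinv _hμX k
    (mul_nonneg hA0 hD'0) hkd hkL _hlam hφ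
  obtain ⟨ψ', hψ', hψn⟩ := exists_hasDerivAt_koopman_eigenfunction hinv _hμX k
    (mul_nonneg hA0 hD'0) hkd hkL hnu hψ
  rw [_hψ1, mul_one] at hψn
  have hU0 := koopman_zero (Φ := Φ) hinv
  have hUadd := koopman_add (Φ := Φ) hinv
  have hskew : ∀ {f f' : Lp ℂ 2 μ}, HasDerivAt (fun t => koopman Φ hinv t f) f' 0 →
      (∀ᵐ x ∂μ, (f x).im = 0) → (inner ℂ f f' : ℂ) = 0 := by
    intro f f' hf hr
    have h1 := im_inner_deriv_eq_zero hf (im_inner_koopman_eq_zero hinv hr hr)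
    have h2 := inner_deriv_eq_neg hU0 hf hf
    rw [← inner_conj_symm f' f] at h2
    have h3 := congrArg Complex.re h2
    rw [Complex.neg_re, Complex.conj_re] at h3
    exact Complex.ext (by rw [Complex.zero_re]; linarith) h1
  have hφφ' := hskew hφ' _hφr
  have hψψ' := hskew hψ' _hψr
  set ω : ℝ := (inner ℂ φ ψ' : ℂ).re with hω
  have hφψ' : (inner ℂ φ ψ' : ℂ) = (ω : ℂ) :=
    Complex.ext (by simp [hω])
      (by simpa using im_inner_deriv_eq_zero hψ' (im_inner_koopman_eq_zero hinv _hφr _hψr))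
  have hψφ' : (inner ℂ ψ φ' : ℂ) = -(ω : ℂ) := by
    have h1 := inner_deriv_eq_neg hU0 hφ' hψ'
    rw [hφψ'] at h1
    have h2 : (inner ℂ φ' ψ : ℂ) = -(ω : ℂ) := by linear_combination h1
    rw [← inner_conj_symm, h2, map_neg, Complex.conj_ofReal]
  set q : ℂ := ((1 / Real.sqrt 2 : ℝ) : ℂ) with hq
  set z' := q • (φ' + Complex.I • ψ') with hz'
  have hdz : HasDerivAt (fun t => koopman Φ hinv t z) z' 0 := by
    have := (hφ'.add (hψ'.const_smul Complex.I)).const_smul q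
    refine this.congr_of_eventuallyEq (Eventually.of_forall fun t => ?_)
    simp [_hz]
  have hzz' : (inner ℂ z z' : ℂ) = Complex.I * ω := by
    rw [_hz, hz', inner_smul_left, inner_smul_right, inner_add_left, inner_add_right,
      inner_add_right, inner_smul_left, inner_smul_left, inner_smul_right, inner_smul_right, hφφ',
      hψψ', hφψ', hψφ', Complex.conj_I, hq, Complex.conj_ofReal, ← mul_assoc,
      ofReal_inv_sqrt_two_sq]
    ring
  have hz1 : ‖z‖ = 1 := by rw [_hz]; exact norm_combination_eq_one _hφ1 _hψ1 _hφψ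
  have hz0 : z ≠ 0 := fun h0 => by simp [h0] at hz1
  have hφm : φ ∈ (generator Φ hinv).domain := hφ'.differentiableAt
  have hψm : ψ ∈ (generator Φ hinv).domain := hψ'.differentiableAt
  have hzm : z ∈ (generator Φ hinv).domain := hdz.differentiableAt
  -- the error bound
  set R := ‖z' - (Complex.I * ω) • z‖ with hR
  have hδ0 : 0 ≤ δ := by
    rw [_hδ]
    exact mul_nonneg (by positivity) (by linarith)
  have hδ'0 : 0 ≤ δ' := by rw [_hδ']; positivity
  have hC10 : 0 ≤ C₁ := by rw [_hC₁]; positivity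
  set Q := C₂ * vectorFieldNorm I v * (1 + δ') / lam with hQ
  have hQ' : Q = 2 * (A * D') * (1 + δ') / lam := by rw [hQ, _hC₂, hD']; ring
  have hψQ : ‖ψ'‖ ≤ Q := by
    refine hψn.trans ?_
    rw [hQ']
    have h0 : 0 ≤ A * D' := mul_nonneg hA0 hD'0
    exact div_le_div₀ (by positivity) (by nlinarith) _hlam _hlamnu
  have hQ0 : 0 ≤ Q := (norm_nonneg _).trans hψQ
  have hres : γ * R ≤ C₁ / (2 * T) + δ * Q := by
    have h1 := gap_mul_norm_residual_le hU0 (by positivity) hcomm hKsymm hφ hψ _hlamnu _hφ1 _hψ1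
      _hφψ hφ' hψ' hφφ' hψψ' hφψ' hψφ' hgap
    rw [← _hz, ← _hδ] at h1
    refine h1.trans (add_le_add (le_of_eq ?_) (mul_le_mul_of_nonneg_left hψQ hδ0))
    rw [_hC₁]
    field_simp
  have hbound : ∀ τ : ℝ, 0 ≤ τ → ∀ t ∈ Icc 0 τ,
      IsApproxEigenpair (koopman Φ hinv t) (ε τ) (Complex.exp (Complex.I * ω * t)) z := by
    intro τ hτ t ht
    refine ⟨hz0, ?_⟩
    rw [hz1, mul_one, _hε, _hS]
    simp only [_hs]
    refine le_add_three_mul_sqrt hγ0 hC10 hT hδ0 hQ0 hτ ?_ ?_ hres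
    · refine (norm_sub_le _ _).trans ?_
      rw [LinearIsometry.norm_map, norm_smul, hz1, Complex.norm_exp]
      norm_num
    · exact (norm_orbit_sub_exp_smul_le hU0 hUadd hdz ω ht.1).trans
        (mul_le_mul_of_nonneg_left ht.2 (norm_nonneg _))
  -- the continuous representative
  have hint : Integrable (fun y => φ y / (lam : ℂ) + Complex.I * (ψ y / (nu : ℂ))) μ :=
    ((integrable_of_Lp φ).div_const _).add (((integrable_of_Lp ψ).div_const _).const_mul _)
  have hζ : ζ = fun x => q *
      kernelIntegral μ k (fun y => φ y / (lam : ℂ) + Complex.I * (ψ y / (nu : ℂ))) x := funext _hζ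
  have hζae : ζ =ᵐ[μ] z := by
    have hlam' : (lam : ℂ) ≠ 0 := Complex.ofReal_ne_zero.2 _hlam.ne'
    have hnu' : (nu : ℂ) ≠ 0 := Complex.ofReal_ne_zero.2 hnu.ne'
    have e1 := coeFn_kernelOp k φ
    have e2 := coeFn_kernelOp k ψ
    rw [show kernelOp μ k φ = (lam : ℂ) • φ from hφ] at e1
    rw [show kernelOp μ k ψ = (nu : ℂ) • ψ from hψ] at e2
    rw [_hz]
    filter_upwards [e1, e2, Lp.coeFn_smul (lam : ℂ) φ, Lp.coeFn_smul (nu : ℂ) ψ,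
      Lp.coeFn_smul q (φ + Complex.I • ψ), Lp.coeFn_add φ (Complex.I • ψ),
      Lp.coeFn_smul Complex.I ψ] with x h1 h2 h3 h4 h5 h6 h7
    have hsplit : kernelIntegral μ k (fun y => φ y / (lam : ℂ) + Complex.I * (ψ y / (nu : ℂ))) x
        = kernelIntegral μ k φ x / lam + Complex.I * (kernelIntegral μ k ψ x / nu) := by
      simp only [kernelIntegral, ← integral_div, ← integral_const_mul]
      rw [← integral_add ((integrable_kernel_mul k (integrable_of_Lp φ) x).div_const _)
        (((integrable_kernel_mul k (integrable_of_Lp ψ) x).div_const _).const_mul _)]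
      refine integral_congr_ae (Eventually.of_forall fun y => ?_)
      simp only
      ring
    rw [hζ]
    simp only
    rw [hsplit, ← h1, ← h2, h3, h4, h5, Pi.smul_apply, Pi.smul_apply, Pi.smul_apply, h6,
      Pi.add_apply, h7, Pi.smul_apply]
    simp only [smul_eq_mul]
    field_simp
  refine ⟨hφm, hψm, hzm, ω, ?_, ?_, ?_, hγ0, ?_, hbound, ?_, ?_, hζae⟩
  · rw [generator_apply_eq hinv hdz, hzz', one_div, inv_mul_cancel_left₀ Complex.I_ne_zero]
  · rw [generator_apply_eq hinv hψ', hφψ']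
  · rw [← hzz']
    exact hasDerivAt_inner_orbit hdz z
  · intro t ht
    have := hbound t ht t ⟨ht, le_rfl⟩
    exact ⟨⟨z, this⟩, this⟩
  · exact fun x => integrable_kernel_mul k hint x
  · rw [hζ]
    exact continuous_const.mul (continuous_kernelIntegral k hint)
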